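/- Let $\mathbb{C},\mathbb{D}$ be 2-categories and $J:\mathbb{C}\to\mathbb{D}$ a pseudofunctor. **Relative pseudomonads.** A *relative pseudomonad* $T$ over $J$ consists of an object $TX\in\mathbb{D}$ for each $X\in\mathbb{C}$, functors $(-)^*:\mathbb{D}[JX,TY]\to\mathbb{D}[TX,TY]$, 1-cells $i_X:JX\to TX$, and invertible 2-cells $\mu_{g,f}:(g^*f)^*\to g^*f^*$ (natural in $f:JX\to TY$ and $g:JY\to TZ$), $\eta_f:f\to f^*i_X$ (natural in $f$) and $\theta_X:i_X^*\to 1_{TX}$, such that for $f:JX\to TY$, $g:JY\to TZ$, $h:JZ\to TV$ $$(h^*\mu_{g,f})\circ\mu_{h,g^*f}\circ(\text{the 2-cell }((h^*g)^*f)^*\xrightarrow{(\mu_{h,g}f)^*}(h^*g^*f)^*)=(\mu_{h,g}f^*)\circ\mu_{h^*g,f},\qquad (f^*\theta_X)\circ\mu_{f,i_X}\circ(\eta_f)^*=1_{f^*}.$$ The same definition applies when $\mathbb{C}$, $\mathbb{D}$ are bicategories, inserting the associativity and unit constraints. The *Kleisli bicategory* $\mathrm{Kl}(T)$ has the objects of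 $\mathbb{C}$, hom-categories $\mathrm{Kl}(T)[X,Y]=\mathbb{D}[JX,TY]$, composite of $f$ and $g$ equal to $g^*f$, identities $i_X$, and constraints given by $\mu,\eta,\theta$. **The 2-monad $S$.** Let $S=(S,e,m)$ be a 2-monad on $\mathbb{D}$ that restricts along $J$ to a 2-monad on $\mathbb{C}$, also written $S$: that is, there is a pseudonatural equivalence $SJ\simeq JS$ with invertible modifications identifying $Je$ with $e_J$ and $Jm$ with $m_J$, coherent with the unit and associativity laws of the two 2-monads (for instance $J$ a 2-functor with $JS=SJ$, $Je=e_J$, $Jm=m_J$ strictly). Then $JA$ is a pseudoalgebra for every strict $S$-algebra $A$ in $\mathbb{C}$, with structure map $SJA\simeq JSA\to JA$. **Lifting.** A *lifting of $T$ to pseudoalgebras for $S$* assigns to each strict $S$-algebra $A$ in $\mathbb{C}$ a pseudoalgebra structure on $TA$; to each pseudomorphism structure on a 1-cell $f:JA\to TB$ ($A,B$ strict algebras) a pseudomorphism structure on $f^*:TA\to TB$; and to each $A$ a pseudomorphism structure on $i_A:JA\to TA$; such that, for pseudomorphisms $f,g$, if $\alpha:f\to g$ is an algebra 2-cell then so is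 $\alpha^*:f^*\to g^*$, and such that the 2-cells $\mu_{g,f}$, $\eta_f$ and $\theta_A$ are algebra 2-cells. For $Y\in\mathbb{C}$ let $t_{SY}:STSY\to TSY$ be the structure map so obtained from the free algebra $SY$. **Theorem.** Suppose that the relative pseudomonad $T$ over $J$ has a lifting to pseudoalgebras for $S$. Then: 1. There is a relative pseudomonad $\tilde S$ over the identity of $\mathrm{Kl}(T)$ (a pseudomonad on $\mathrm{Kl}(T)$ in extension form) which extends $S$: on objects $\tilde SX=SX$; its unit at $X$ is $JX\xrightarrow{e_{JX}}SJX\simeq JSX\xrightarrow{i_{SX}}TSX$; and the extension of $f:JX\to TSY$ is $$f^{\tilde S}:\ JSX\simeq SJX\xrightarrow{Sf}STSY\xrightarrow{t_{SY}}TSY,$$ with the corresponding action on 2-cells. 2. $\tilde S$ can be chosen so that $X\mapsto TS(X)$ carries the structure of a relative pseudomonad over $J$ obtained by composing the Kleisli relative pseudoadjunction of $T$ with the Kleisli pseudoadjunction of $\tilde S$. Explicitly: its units are those of $\tilde S$, the extension of $f:JX\to TSY$ is $(f^{\tilde S})^*:TSX\to TSY$ (and likewise on 2-cells), and its structural 2-cells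 are $$\eta_f=\eta^{\tilde S}_f,\qquad \mu_{g,f}=\mu^{T}_{g^{\tilde S},f^{\tilde S}}\circ(\mu^{\tilde S}_{g,f})^*,\qquad \theta_X=\theta^{T}_{SX}\circ(\theta^{\tilde S}_X)^*.$$ -/

import Mathlib

open CategoryTheory Bicategory

universe w₁ w₂ v₁ v₂ u₁ u₂

/-! ### Relative pseudomonads -/

section Relative

variable {C : Type u₁} [Bicategory.{w₁, v₁} C] {D : Type u₂} [Bicategory.{w₂, v₂} D]

/-- The object function, unit and extension functors `(-)^*` of a relative pseudomonad. -/
structure KleisliTriple (J : C ⥤ᵖ D) where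
  obj : C → D
  unit (X : C) : J.obj X ⟶ obj X
  ext {X Y : C} : (J.obj X ⟶ obj Y) ⥤ (obj X ⟶ obj Y)

/-- All the data of a relative pseudomonad; composites are written in diagrammatic order,
so that `f ≫ ext.obj g` is the composite `g^* f`. -/
structure RelPseudomonadData (J : C ⥤ᵖ D) extends KleisliTriple J where
  mu {X Y Z : C} (g : J.obj Y ⟶ obj Z) (f : J.obj X ⟶ obj Y) :
    ext.obj (f ≫ ext.obj g) ≅ ext.obj f ≫ ext.obj g
  eta {X Y : C} (f : J.obj X ⟶ obj Y) : f ≅ unit X ≫ ext.obj f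
  theta (X : C) : ext.obj (unit X) ≅ 𝟙 (obj X)

/-- A relative pseudomonad over the pseudofunctor `J`. For `J` the identity this is a pseudomonad
in extension (no-iteration) form. -/
structure RelPseudomonad (J : C ⥤ᵖ D) extends RelPseudomonadData J where
  /-- naturality of `mu g f` in `f` -/
  mu_naturality_right {X Y Z : C} (g : J.obj Y ⟶ obj Z) {f f' : J.obj X ⟶ obj Y} (α : f ⟶ f') :
    ext.map (α ▷ ext.obj g) ≫ (mu g f').hom = (mu g f).hom ≫ ext.map α ▷ ext.obj g
  /-- naturality of `mu g f` in `g` -/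
  mu_naturality_left {X Y Z : C} {g g' : J.obj Y ⟶ obj Z} (β : g ⟶ g') (f : J.obj X ⟶ obj Y) :
    ext.map (f ◁ ext.map β) ≫ (mu g' f).hom = (mu g f).hom ≫ ext.obj f ◁ ext.map β
  eta_naturality {X Y : C} {f f' : J.obj X ⟶ obj Y} (α : f ⟶ f') :
    α ≫ (eta f').hom = (eta f).hom ≫ unit X ◁ ext.map α
  associativity {X Y Z V : C} (h : J.obj Z ⟶ obj V) (g : J.obj Y ⟶ obj Z)
      (f : J.obj X ⟶ obj Y) :
    ext.map (f ◁ (mu h g).hom) ≫ ext.map (α_ f (ext.obj g) (ext.obj h)).inv ≫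
        (mu h (f ≫ ext.obj g)).hom ≫ (mu g f).hom ▷ ext.obj h =
      (mu (g ≫ ext.obj h) f).hom ≫ ext.obj f ◁ (mu h g).hom ≫
        (α_ (ext.obj f) (ext.obj g) (ext.obj h)).inv
  unitality {X Y : C} (f : J.obj X ⟶ obj Y) :
    ext.map (eta f).hom ≫ (mu f (unit X)).hom ≫ (theta X).hom ▷ ext.obj f =
      (λ_ (ext.obj f)).inv

namespace RelPseudomonad

variable {J : C ⥤ᵖ D} (T : RelPseudomonad J)

theorem unit_whiskerLeft_ext {X Y : C} {f g : J.obj X ⟶ T.obj Y} (α : f ⟶ g) :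
    T.unit X ◁ T.ext.map α = (T.eta f).inv ≫ α ≫ (T.eta g).hom := by
  rw [T.eta_naturality, Iso.inv_hom_id_assoc]

theorem ext_map_whiskerLeft {X Y Z : C} (f : J.obj X ⟶ T.obj Y) {g g' : J.obj Y ⟶ T.obj Z}
    (β : g ⟶ g') :
    T.ext.map (f ◁ T.ext.map β) =
      (T.mu g f).hom ≫ T.ext.obj f ◁ T.ext.map β ≫ (T.mu g' f).inv := by
  rw [← reassoc_of% T.mu_naturality_left, Iso.hom_inv_id, Category.comp_id]

theorem ext_map_whiskerRight {X Y Z : C} {f f' : J.obj X ⟶ T.obj Y} (α : f ⟶ f')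
    (g : J.obj Y ⟶ T.obj Z) :
    T.ext.map (α ▷ T.ext.obj g) =
      (T.mu g f).hom ≫ T.ext.map α ▷ T.ext.obj g ≫ (T.mu g f').inv := by
  rw [← reassoc_of% T.mu_naturality_right, Iso.hom_inv_id, Category.comp_id]

theorem pentagon_aux {W X Y Z V : C} (f : J.obj W ⟶ T.obj X) (g : J.obj X ⟶ T.obj Y)
    (h : J.obj Y ⟶ T.obj Z) (k : J.obj Z ⟶ T.obj V) :
    ((α_ f (T.ext.obj g) (T.ext.obj h)).hom ≫ f ◁ (T.mu h g).inv) ▷ T.ext.obj k ≫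
        ((α_ f (T.ext.obj (g ≫ T.ext.obj h)) (T.ext.obj k)).hom ≫
          f ◁ (T.mu k (g ≫ T.ext.obj h)).inv) ≫
        f ◁ T.ext.map ((α_ g (T.ext.obj h) (T.ext.obj k)).hom ≫ g ◁ (T.mu k h).inv) =
      ((α_ (f ≫ T.ext.obj g) (T.ext.obj h) (T.ext.obj k)).hom ≫
          (f ≫ T.ext.obj g) ◁ (T.mu k h).inv) ≫
        (α_ f (T.ext.obj g) (T.ext.obj (h ≫ T.ext.obj k))).hom ≫
          f ◁ (T.mu (h ≫ T.ext.obj k) g).inv := by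
  have key : (T.mu h g).inv ▷ T.ext.obj k ≫ (T.mu k (g ≫ T.ext.obj h)).inv ≫
      T.ext.map (α_ g (T.ext.obj h) (T.ext.obj k)).hom ≫ T.ext.map (g ◁ (T.mu k h).inv) =
      (α_ _ _ _).hom ≫ T.ext.obj g ◁ (T.mu k h).inv ≫ (T.mu (h ≫ T.ext.obj k) g).inv := by
    have := T.associativity k h g
    have e : (whiskerRightIso (T.mu h g) (T.ext.obj k)).symm ≪≫ (T.mu k (g ≫ T.ext.obj h)).symm ≪≫
      T.ext.mapIso (α_ g (T.ext.obj h) (T.ext.obj k)) ≪≫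
        T.ext.mapIso (whiskerLeftIso g (T.mu k h).symm) =
      α_ _ _ _ ≪≫ whiskerLeftIso (T.ext.obj g) (T.mu k h).symm ≪≫
        (T.mu (h ≫ T.ext.obj k) g).symm := by
      rw [← Iso.symm_eq_iff]
      ext
      simpa using this
    simpa using congrArg Iso.hom e
  have key' := congrArg (fun t => f ◁ t) key
  simp only [whiskerLeft_comp] at key'
  simp only [comp_whiskerRight, whisker_assoc, Category.assoc, Functor.map_comp,
    whiskerLeft_comp, comp_whiskerLeft, Iso.inv_hom_id_assoc]
  rw [key']
  simp

theorem triangle_aux {X Y Z : C} (f : J.obj X ⟶ T.obj Y) (g : J.obj Y ⟶ T.obj Z) :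
    ((α_ f (T.ext.obj (T.unit Y)) (T.ext.obj g)).hom ≫ f ◁ (T.mu g (T.unit Y)).inv) ≫
        f ◁ T.ext.map (T.eta g).inv =
      (f ◁ (T.theta Y).hom ≫ (ρ_ f).hom) ▷ T.ext.obj g := by
  have key : (T.mu g (T.unit Y)).inv ≫ T.ext.map (T.eta g).inv =
      (T.theta Y).hom ▷ T.ext.obj g ≫ (λ_ _).hom := by
    rw [Iso.inv_comp_eq, ← cancel_epi (T.ext.map (T.eta g).hom), ← Functor.map_comp,
      Iso.hom_inv_id, reassoc_of% T.unitality g]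
    simp
  have key' := congrArg (fun t => f ◁ t) key
  simp only [whiskerLeft_comp] at key'
  simp only [Category.assoc, key']
  simp

theorem comp_whiskerLeft_aux {W X Y Z : C} (f : J.obj W ⟶ T.obj X) (g : J.obj X ⟶ T.obj Y)
    {h h' : J.obj Y ⟶ T.obj Z} (η : h ⟶ h') :
    (f ≫ T.ext.obj g) ◁ T.ext.map η =
      ((α_ f (T.ext.obj g) (T.ext.obj h)).hom ≫ f ◁ (T.mu h g).inv) ≫
        f ◁ T.ext.map (g ◁ T.ext.map η) ≫
          f ◁ (T.mu h' g).hom ≫ (α_ f (T.ext.obj g) (T.ext.obj h')).inv := by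
  rw [T.ext_map_whiskerLeft]
  simp

theorem whiskerRight_id_aux {X Y : C} {f g : J.obj X ⟶ T.obj Y} (η : f ⟶ g) :
    η ▷ T.ext.obj (T.unit Y) =
      (f ◁ (T.theta Y).hom ≫ (ρ_ f).hom) ≫ η ≫ (ρ_ g).inv ≫ g ◁ (T.theta Y).inv := by
  have : η = (ρ_ f).inv ≫ η ▷ 𝟙 _ ≫ (ρ_ g).hom := by simp
  conv_rhs => rw [this]
  simp only [Category.assoc, Iso.hom_inv_id_assoc]
  rw [whisker_exchange_assoc]
  simp [-whiskerRight_id]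

theorem whiskerRight_comp_aux {W X Y Z : C} {f f' : J.obj W ⟶ T.obj X} (η : f ⟶ f')
    (g : J.obj X ⟶ T.obj Y) (h : J.obj Y ⟶ T.obj Z) :
    η ▷ T.ext.obj (g ≫ T.ext.obj h) =
      (f ◁ (T.mu h g).hom ≫ (α_ f (T.ext.obj g) (T.ext.obj h)).inv) ≫
        (η ▷ T.ext.obj g) ▷ T.ext.obj h ≫
          (α_ f' (T.ext.obj g) (T.ext.obj h)).hom ≫ f' ◁ (T.mu h g).inv := by
  have : (η ▷ T.ext.obj g) ▷ T.ext.obj h =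
      (α_ _ _ _).hom ≫ η ▷ (T.ext.obj g ≫ T.ext.obj h) ≫ (α_ _ _ _).inv := by simp
  rw [this]
  simp only [Category.assoc, Iso.inv_hom_id_assoc]
  rw [whisker_exchange_assoc]
  simp [-whiskerRight_comp]

theorem whisker_assoc_aux {W X Y Z : C} (f : J.obj W ⟶ T.obj X) {g g' : J.obj X ⟶ T.obj Y}
    (η : g ⟶ g') (h : J.obj Y ⟶ T.obj Z) :
    (f ◁ T.ext.map η) ▷ T.ext.obj h =
      ((α_ f (T.ext.obj g) (T.ext.obj h)).hom ≫ f ◁ (T.mu h g).inv) ≫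
        f ◁ T.ext.map (η ▷ T.ext.obj h) ≫
          f ◁ (T.mu h g').hom ≫ (α_ f (T.ext.obj g') (T.ext.obj h)).inv := by
  rw [T.ext_map_whiskerRight]
  simp

end RelPseudomonad

/-! ### The Kleisli bicategory -/

/-- The objects of the Kleisli bicategory of `T` are those of `C`. -/
structure KleisliBicat {J : C ⥤ᵖ D} (T : RelPseudomonad J) where
  of : C

namespace KleisliBicat

variable {J : C ⥤ᵖ D} (T : RelPseudomonad J)

/-- A morphism `X ⟶ Y` is a morphism `J X ⟶ T Y` of `D`; the composite of `f` and `g` is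
`g^* f`, and the identity is the unit of `T`. -/
instance : CategoryStruct (KleisliBicat T) where
  Hom X Y := J.obj X.of ⟶ T.obj Y.of
  id X := T.unit X.of
  comp f g := f ≫ T.ext.obj g

/-- The associativity constraint is given by `mu`, the unit constraints by `eta` and `theta`. -/
instance : Bicategory (KleisliBicat T) where
  homCategory X Y := inferInstanceAs (Category (J.obj X.of ⟶ T.obj Y.of))
  whiskerLeft {X Y Z} f g h β :=
    Bicategory.whiskerLeft (B := D) (b := T.obj Y.of) (c := T.obj Z.of) f (T.ext.map β)
  whiskerRight {X Y Z} f g α h :=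
    Bicategory.whiskerRight (B := D) (b := T.obj Y.of) (c := T.obj Z.of) α (T.ext.obj h)
  associator {X Y Z V} f g h :=
    Bicategory.associator (B := D) (b := T.obj Y.of) (c := T.obj Z.of) (d := T.obj V.of)
        f (T.ext.obj g) (T.ext.obj h) ≪≫
      whiskerLeftIso (B := D) (b := T.obj Y.of) (c := T.obj V.of) f (T.mu h g).symm
  leftUnitor f := (T.eta f).symm
  rightUnitor {X Y} f :=
    whiskerLeftIso (B := D) (b := T.obj Y.of) (c := T.obj Y.of) f (T.theta Y.of) ≪≫
      Bicategory.rightUnitor (B := D) (b := T.obj Y.of) f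
  whiskerLeft_id {X Y Z} f g := by
    change (f : J.obj X.of ⟶ T.obj Y.of) ◁ T.ext.map (𝟙 (show J.obj Y.of ⟶ T.obj Z.of from g)) = 𝟙 _
    simp
  whiskerLeft_comp {X Y Z} f g h i η θ := by
    change (f : J.obj X.of ⟶ T.obj Y.of) ◁ T.ext.map (_ ≫ _) = f ◁ _ ≫ f ◁ _
    simp
  id_whiskerLeft η := T.unit_whiskerLeft_ext η
  comp_whiskerLeft f g _ _ η := T.comp_whiskerLeft_aux f g η
  id_whiskerRight f g := id_whiskerRight (B := D) f (T.ext.obj g)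
  comp_whiskerRight η θ i := comp_whiskerRight (B := D) η θ (T.ext.obj i)
  whiskerRight_id η := T.whiskerRight_id_aux η
  whiskerRight_comp η g h := T.whiskerRight_comp_aux η g h
  whisker_assoc f _ _ η h := T.whisker_assoc_aux f η h
  whisker_exchange {X Y Z} f g h i η θ := whisker_exchange (B := D) η (T.ext.map θ)
  pentagon f g h i := T.pentagon_aux f g h i
  triangle f g := T.triangle_aux f g

end KleisliBicat

end Relative

/-! ### 2-monads, their algebras, and restriction along a pseudofunctor -/

section TwoMonads

/-- A 2-monad on a 2-category: a 2-functor with a 2-natural unit and a 2-natural multiplication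
which satisfy the monad laws strictly. -/
structure TwoMonad (B : Type u₁) [Bicategory.{w₁, v₁} B] [Strict B] where
  functor : StrictPseudofunctor B B
  unit (X : B) : X ⟶ functor.obj X
  mul (X : B) : functor.obj (functor.obj X) ⟶ functor.obj X
  unit_naturality {X Y : B} (f : X ⟶ Y) : f ≫ unit Y = unit X ≫ functor.map f
  unit_naturality₂ {X Y : B} {f g : X ⟶ Y} (α : f ⟶ g) :
    α ▷ unit Y ≫ eqToHom (unit_naturality g) =
      eqToHom (unit_naturality f) ≫ unit X ◁ functor.map₂ α
  mul_naturality {X Y : B} (f : X ⟶ Y) :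
    functor.map (functor.map f) ≫ mul Y = mul X ≫ functor.map f
  mul_naturality₂ {X Y : B} {f g : X ⟶ Y} (α : f ⟶ g) :
    functor.map₂ (functor.map₂ α) ▷ mul Y ≫ eqToHom (mul_naturality g) =
      eqToHom (mul_naturality f) ≫ mul X ◁ functor.map₂ α
  mul_assoc (X : B) : functor.map (mul X) ≫ mul X = mul (functor.obj X) ≫ mul X
  unit_mul (X : B) : unit (functor.obj X) ≫ mul X = 𝟙 (functor.obj X)
  map_unit_mul (X : B) : functor.map (unit X) ≫ mul X = 𝟙 (functor.obj X)

variable {B : Type u₁} [Bicategory.{w₁, v₁} B] [Strict B]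

/-- A strict algebra structure on `A` for the 2-monad `S`. -/
structure StrictAlgebra (S : TwoMonad B) (A : B) where
  act : S.functor.obj A ⟶ A
  assoc : S.functor.map act ≫ act = S.mul A ≫ act
  unit : S.unit A ≫ act = 𝟙 A

/-- The free (strict) algebra on `X`. -/
def TwoMonad.free (S : TwoMonad B) (X : B) : StrictAlgebra S (S.functor.obj X) where
  act := S.mul X
  assoc := S.mul_assoc X
  unit := S.unit_mul X

/-- The data of a pseudoalgebra structure on `A` for the 2-monad `S`: a structure map and
invertible associativity and unit 2-cells. -/
structure PseudoAlgebraData (S : TwoMonad B) (A : B) where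
  act : S.functor.obj A ⟶ A
  assoc : S.functor.map act ≫ act ≅ S.mul A ≫ act
  unit : 𝟙 A ≅ S.unit A ≫ act

/-- A pseudoalgebra structure on `A` for the 2-monad `S`. -/
structure PseudoAlgebra (S : TwoMonad B) (A : B) extends PseudoAlgebraData S A where
  /-- The two composites `S S act ≫ S act ≫ act ⟶ mul ≫ mul ≫ act` agree. -/
  assoc_coherence :
    S.functor.map (S.functor.map act) ◁ assoc.hom ⊗≫
        eqToHom (S.mul_naturality act) ▷ act ⊗≫
        S.mul (S.functor.obj A) ◁ assoc.hom =
      𝟙 _ ⊗≫ ((S.functor.mapComp (S.functor.map act) act).inv ≫ S.functor.map₂ assoc.hom ≫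
          (S.functor.mapComp (S.mul A) act).hom) ▷ act ⊗≫
        S.functor.map (S.mul A) ◁ assoc.hom ⊗≫
        eqToHom (S.mul_assoc A) ▷ act ⊗≫ 𝟙 _
  /-- The composite `act ⟶ S unit ≫ S act ≫ act ⟶ S unit ≫ mul ≫ act = act` is the identity. -/
  unit_coherence :
    𝟙 act ⊗≫ ((S.functor.mapId A).inv ≫ S.functor.map₂ unit.hom ≫
          (S.functor.mapComp (S.unit A) act).hom) ▷ act ⊗≫
        S.functor.map (S.unit A) ◁ assoc.hom ⊗≫
        eqToHom (S.map_unit_mul A) ▷ act ⊗≫ 𝟙 act = 𝟙 act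

variable {S : TwoMonad B}

/-- A pseudomorphism structure on `f : X ⟶ Y`, for pseudoalgebra structures `a` on `X` and
`b` on `Y`. The conditions involve only the data of `a` and `b`. -/
structure PseudoMor {X Y : B} (a : PseudoAlgebraData S X) (b : PseudoAlgebraData S Y) (f : X ⟶ Y) where
  cell : S.functor.map f ≫ b.act ≅ a.act ≫ f
  /-- The two composites `S S f ≫ S b ≫ b ⟶ mul ≫ a ≫ f` agree. -/
  assoc_coherence :
    S.functor.map (S.functor.map f) ◁ b.assoc.hom ⊗≫
        eqToHom (S.mul_naturality f) ▷ b.act ⊗≫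
        S.mul X ◁ cell.hom =
      𝟙 _ ⊗≫ ((S.functor.mapComp (S.functor.map f) b.act).inv ≫ S.functor.map₂ cell.hom ≫
          (S.functor.mapComp a.act f).hom) ▷ b.act ⊗≫
        S.functor.map a.act ◁ cell.hom ⊗≫
        a.assoc.hom ▷ f ⊗≫ 𝟙 _
  /-- The two composites `f ⟶ unit ≫ a ≫ f` agree. -/
  unit_coherence :
    𝟙 f ⊗≫ f ◁ b.unit.hom ⊗≫ eqToHom (S.unit_naturality f) ▷ b.act ⊗≫ S.unit X ◁ cell.hom =
      𝟙 f ⊗≫ a.unit.hom ▷ f ⊗≫ 𝟙 _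

/-- `α` is an algebra 2-cell between the pseudomorphisms `(f, φ)` and `(g, ψ)`. -/
def IsAlgebraCell {X Y : B} {a : PseudoAlgebraData S X} {b : PseudoAlgebraData S Y} {f g : X ⟶ Y}
    (φ : PseudoMor a b f) (ψ : PseudoMor a b g) (α : f ⟶ g) : Prop :=
  S.functor.map₂ α ▷ b.act ≫ ψ.cell.hom = φ.cell.hom ≫ a.act ◁ α

/-- The pasting computation behind the composition of pseudomorphisms. -/
theorem PseudoMor.comp_aux {X Y Z X1 Y1 Z1 X2 Y2 Z2 : B}
  {f : X ⟶ Y} {g : Y ⟶ Z} {f1 : X1 ⟶ Y1} {g1 : Y1 ⟶ Z1} {f2 : X2 ⟶ Y2} {g2 : Y2 ⟶ Z2}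
  {a : X1 ⟶ X} {b : Y1 ⟶ Y} {c : Z1 ⟶ Z} {a1 : X2 ⟶ X1} {b1 : Y2 ⟶ Y1} {c1 : Z2 ⟶ Z1}
  {mX : X2 ⟶ X1} {mY : Y2 ⟶ Y1} {mZ : Z2 ⟶ Z1}
  (nf : f2 ≫ mY ⟶ mX ≫ f1) (ng : g2 ≫ mZ ⟶ mY ≫ g1)
  (φ : f1 ≫ b ⟶ a ≫ f) (ψ : g1 ≫ c ⟶ b ≫ g)
  (φ1 : f2 ≫ b1 ⟶ a1 ≫ f1) (ψ1 : g2 ≫ c1 ⟶ b1 ≫ g1)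
  (A : a1 ≫ a ⟶ mX ≫ a) (Bb : b1 ≫ b ⟶ mY ≫ b) (Cc : c1 ≫ c ⟶ mZ ≫ c)
  (hφ : f2 ◁ Bb ⊗≫ nf ▷ b ⊗≫ mX ◁ φ = 𝟙 _ ⊗≫ φ1 ▷ b ⊗≫ a1 ◁ φ ⊗≫ A ▷ f ⊗≫ 𝟙 _)
  (hψ : g2 ◁ Cc ⊗≫ ng ▷ c ⊗≫ mY ◁ ψ = 𝟙 _ ⊗≫ ψ1 ▷ c ⊗≫ b1 ◁ ψ ⊗≫ Bb ▷ g ⊗≫ 𝟙 _) :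
  f2 ◁ g2 ◁ Cc ⊗≫ f2 ◁ ng ▷ c ⊗≫ nf ▷ g1 ▷ c ⊗≫ mX ◁ f1 ◁ ψ ⊗≫ mX ◁ φ ▷ g ⊗≫ 𝟙 _ =
    𝟙 _ ⊗≫ f2 ◁ ψ1 ▷ c ⊗≫ φ1 ▷ g1 ▷ c ⊗≫ a1 ◁ f1 ◁ ψ ⊗≫ a1 ◁ φ ▷ g ⊗≫ A ▷ f ▷ g ⊗≫ 𝟙 ((mX ≫ a) ≫ f ≫ g) := by
  calc
   _ = f2 ◁ g2 ◁ Cc ⊗≫ f2 ◁ ng ▷ c ⊗≫ (nf ▷ (g1 ≫ c) ≫ (mX ≫ f1) ◁ ψ) ⊗≫ mX ◁ φ ▷ g ⊗≫ 𝟙 _ := by bicategory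
   _ = f2 ◁ (g2 ◁ Cc ⊗≫ ng ▷ c ⊗≫ mY ◁ ψ) ⊗≫ nf ▷ b ▷ g ⊗≫ mX ◁ φ ▷ g ⊗≫ 𝟙 _ := by
      rw [← whisker_exchange]; bicategory
   _ = 𝟙 _ ⊗≫ f2 ◁ ψ1 ▷ c ⊗≫ f2 ◁ b1 ◁ ψ ⊗≫ (f2 ◁ Bb ⊗≫ nf ▷ b ⊗≫ mX ◁ φ) ▷ g ⊗≫ 𝟙 _ := by
      rw [hψ]; bicategory
   _ = 𝟙 _ ⊗≫ f2 ◁ ψ1 ▷ c ⊗≫ ((f2 ≫ b1) ◁ ψ ≫ φ1 ▷ (b ≫ g)) ⊗≫ a1 ◁ φ ▷ g ⊗≫ A ▷ f ▷ g ⊗≫ 𝟙 _ := by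
      rw [hφ]; bicategory
   _ = _ := by
      rw [whisker_exchange]; bicategory

namespace TwoMonad

variable (S : TwoMonad B)

theorem mul_naturality_comp {X Y Z : B} (f : X ⟶ Y) (g : Y ⟶ Z) :
    eqToHom (S.mul_naturality (f ≫ g)) =
      (S.functor.map₂ (S.functor.mapComp f g).hom ≫
          (S.functor.mapComp (S.functor.map f) (S.functor.map g)).hom) ▷ S.mul Z ≫
        (α_ _ _ _).hom ≫ S.functor.map (S.functor.map f) ◁ eqToHom (S.mul_naturality g) ≫
        (α_ _ _ _).inv ≫ eqToHom (S.mul_naturality f) ▷ S.functor.map g ≫ (α_ _ _ _).hom ≫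
        S.mul X ◁ (S.functor.mapComp f g).inv := by
  simp [StrictPseudofunctor.mapComp_eq_eqToIso, Strict.associator_eqToIso,
    PrelaxFunctor.map₂_eqToHom]

theorem mul_naturality_id (X : B) :
    eqToHom (S.mul_naturality (𝟙 X)) =
      (S.functor.map₂ (S.functor.mapId X).hom ≫ (S.functor.mapId _).hom) ▷ S.mul X ≫
        (λ_ _).hom ≫ (ρ_ _).inv ≫ S.mul X ◁ (S.functor.mapId X).inv := by
  simp [StrictlyUnitaryPseudofunctor.mapId_eq_eqToIso, Strict.leftUnitor_eqToIso,
    Strict.rightUnitor_eqToIso, PrelaxFunctor.map₂_eqToHom]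

theorem unit_naturality_comp {X Y Z : B} (f : X ⟶ Y) (g : Y ⟶ Z) :
    eqToHom (S.unit_naturality (f ≫ g)) =
      (α_ _ _ _).hom ≫ f ◁ eqToHom (S.unit_naturality g) ≫
        (α_ _ _ _).inv ≫ eqToHom (S.unit_naturality f) ▷ S.functor.map g ≫ (α_ _ _ _).hom ≫
        S.unit X ◁ (S.functor.mapComp f g).inv := by
  simp [StrictPseudofunctor.mapComp_eq_eqToIso, Strict.associator_eqToIso]

theorem unit_naturality_id (X : B) :
    eqToHom (S.unit_naturality (𝟙 X)) =
      (λ_ _).hom ≫ (ρ_ _).inv ≫ S.unit X ◁ (S.functor.mapId X).inv := by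
  simp [StrictlyUnitaryPseudofunctor.mapId_eq_eqToIso, Strict.leftUnitor_eqToIso,
    Strict.rightUnitor_eqToIso]

end TwoMonad

/-- The identity pseudomorphism. -/
def PseudoMor.id {X : B} (a : PseudoAlgebraData S X) : PseudoMor a a (𝟙 X) where
  cell := whiskerRightIso (S.functor.mapId X) a.act ≪≫ λ_ a.act ≪≫ (ρ_ a.act).symm
  assoc_coherence := by
    rw [S.mul_naturality_id]
    have h1 : (S.functor.mapComp (S.functor.map (𝟙 X)) a.act).inv ≫
        S.functor.map₂ ((S.functor.mapId X).hom ▷ a.act ≫ (λ_ a.act).hom ≫ (ρ_ a.act).inv) ≫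
          (S.functor.mapComp a.act (𝟙 X)).hom =
          (S.functor.map₂ (S.functor.mapId X).hom ≫ (S.functor.mapId _).hom) ▷ _ ≫
          (λ_ _).hom ≫ (ρ_ _).inv ≫ _ ◁ (S.functor.mapId X).inv := by
      have h2 : S.functor.map₂ (ρ_ a.act).inv ≫ (S.functor.mapComp a.act (𝟙 X)).hom =
          (ρ_ _).inv ≫ _ ◁ (S.functor.mapId X).inv := by
        rw [S.functor.mapComp_id_right_hom a.act, ← PrelaxFunctor.map₂_comp_assoc]
        simp
      simp [h2]
    simp only [Iso.trans_hom, Bicategory.whiskerRightIso_hom, Iso.symm_hom]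
    rw [h1]
    generalize S.functor.map₂ (S.functor.mapId X).hom ≫ (S.functor.mapId _).hom = k
    calc
      _ = (S.functor.map (S.functor.map (𝟙 X)) ◁ a.assoc.hom ≫ k ▷ (S.mul X ≫ a.act)) ⊗≫
          S.mul X ◁ ((S.functor.mapId X).inv ≫ (S.functor.mapId X).hom) ▷ a.act ⊗≫ 𝟙 _ := by
        bicategory
      _ = k ▷ _ ⊗≫ a.assoc.hom ⊗≫ 𝟙 _ := by
        rw [whisker_exchange, Iso.inv_hom_id]
        bicategory
      _ = 𝟙 _ ⊗≫ k ▷ (S.functor.map a.act ≫ a.act) ⊗≫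
            S.functor.map a.act ◁ ((S.functor.mapId X).inv ≫ (S.functor.mapId X).hom) ▷ a.act ⊗≫
            a.assoc.hom ⊗≫ 𝟙 _ := by
        rw [Iso.inv_hom_id]; bicategory
      _ = _ := by bicategory
  unit_coherence := by
    rw [S.unit_naturality_id]
    simp only [Iso.trans_hom, Bicategory.whiskerRightIso_hom, Iso.symm_hom]
    calc
      _ = 𝟙 _ ⊗≫ a.unit.hom ⊗≫ S.unit X ◁ ((S.functor.mapId X).inv ≫ (S.functor.mapId X).hom) ▷
            a.act ⊗≫ 𝟙 _ := by
        bicategory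
      _ = _ := by
        rw [Iso.inv_hom_id]; bicategory

/-- The composite of two pseudomorphisms. -/
def PseudoMor.comp {X Y Z : B} {a : PseudoAlgebraData S X} {b : PseudoAlgebraData S Y}
    {c : PseudoAlgebraData S Z} {f : X ⟶ Y} {g : Y ⟶ Z} (φ : PseudoMor a b f) (ψ : PseudoMor b c g) :
    PseudoMor a c (f ≫ g) where
  cell := whiskerRightIso (S.functor.mapComp f g) c.act ≪≫ α_ _ _ _ ≪≫
    whiskerLeftIso (S.functor.map f) ψ.cell ≪≫ (α_ _ _ _).symm ≪≫
    whiskerRightIso φ.cell g ≪≫ α_ _ _ _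
  assoc_coherence := by
    rw [S.mul_naturality_comp]
    have key := PseudoMor.comp_aux _ _ _ _ _ _ _ _ _ φ.assoc_coherence ψ.assoc_coherence
    have h1 : (S.functor.mapComp _ _).inv ≫ S.functor.map₂ ((S.functor.mapComp f g).hom ▷ c.act ≫
        (α_ _ _ _).hom ≫ S.functor.map f ◁ ψ.cell.hom ≫ (α_ _ _ _).inv ≫ φ.cell.hom ▷ g ≫
          (α_ _ _ _).hom) ≫ (S.functor.mapComp a.act (f ≫ g)).hom =
          (S.functor.map₂ (S.functor.mapComp f g).hom ≫ (S.functor.mapComp _ _).hom) ▷ _ ≫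
          (α_ _ _ _).hom ≫ _ ◁ ((S.functor.mapComp (S.functor.map g) c.act).inv ≫
            S.functor.map₂ ψ.cell.hom ≫ (S.functor.mapComp b.act g).hom) ≫ (α_ _ _ _).inv ≫
          ((S.functor.mapComp (S.functor.map f) b.act).inv ≫
            S.functor.map₂ φ.cell.hom ≫ (S.functor.mapComp a.act f).hom) ▷ _ ≫
          (α_ _ _ _).hom ≫ S.functor.map a.act ◁ (S.functor.mapComp f g).inv := by
      have h2 : S.functor.map₂ (α_ (S.functor.map f) b.act g).inv =
          (S.functor.mapComp _ _).hom ≫ _ ◁ (S.functor.mapComp _ _).hom ≫ (α_ _ _ _).inv ≫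
            (S.functor.mapComp _ _).inv ▷ _ ≫ (S.functor.mapComp _ _).inv := by
        rw [S.functor.mapComp_assoc_right_hom_assoc]
        simp
      simp [h2]
    simp only [Iso.trans_hom, Bicategory.whiskerRightIso_hom, Bicategory.whiskerLeftIso_hom,
      Iso.symm_hom]
    rw [h1]
    revert key
    generalize S.functor.map₂ (S.functor.mapComp f g).hom ≫ (S.functor.mapComp _ _).hom = k
    generalize (S.functor.mapComp (S.functor.map g) c.act).inv ≫
            S.functor.map₂ ψ.cell.hom ≫ (S.functor.mapComp b.act g).hom = ψ1
    generalize (S.functor.mapComp (S.functor.map f) b.act).inv ≫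
            S.functor.map₂ φ.cell.hom ≫ (S.functor.mapComp a.act f).hom = φ1
    intro key
    calc
      _ = (S.functor.map (S.functor.map (f ≫ g)) ◁ c.assoc.hom ≫ k ▷ (S.mul Z ≫ c.act)) ⊗≫
          S.functor.map (S.functor.map f) ◁ eqToHom (S.mul_naturality g) ▷ c.act ⊗≫
          eqToHom (S.mul_naturality f) ▷ S.functor.map g ▷ c.act ⊗≫
          S.mul X ◁ ((S.functor.mapComp f g).inv ≫ (S.functor.mapComp f g).hom) ▷ c.act ⊗≫
          S.mul X ◁ S.functor.map f ◁ ψ.cell.hom ⊗≫ S.mul X ◁ φ.cell.hom ▷ g ⊗≫ 𝟙 _ := by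
        bicategory
      _ = k ▷ (S.functor.map c.act ≫ c.act) ⊗≫ (S.functor.map (S.functor.map f) ◁ 
            S.functor.map (S.functor.map g) ◁ c.assoc.hom ⊗≫
          S.functor.map (S.functor.map f) ◁ eqToHom (S.mul_naturality g) ▷ c.act ⊗≫
          eqToHom (S.mul_naturality f) ▷ S.functor.map g ▷ c.act ⊗≫
          S.mul X ◁ S.functor.map f ◁ ψ.cell.hom ⊗≫ S.mul X ◁ φ.cell.hom ▷ g ⊗≫
            𝟙 ((S.mul X ≫ a.act) ≫ f ≫ g)) ⊗≫ 𝟙 _ := by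
        rw [whisker_exchange, Iso.inv_hom_id]; bicategory
      _ = 𝟙 _ ⊗≫ k ▷ (S.functor.map c.act ≫ c.act) ⊗≫
          S.functor.map (S.functor.map f) ◁ ψ1 ▷ c.act ⊗≫ φ1 ▷ S.functor.map g ▷ c.act ⊗≫
          S.functor.map a.act ◁ S.functor.map f ◁ ψ.cell.hom ⊗≫
          S.functor.map a.act ◁ φ.cell.hom ▷ g ⊗≫ a.assoc.hom ▷ f ▷ g ⊗≫ 𝟙 _ := by
        rw [key]; bicategory
      _ = 𝟙 _ ⊗≫ k ▷ (S.functor.map c.act ≫ c.act) ⊗≫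
            S.functor.map (S.functor.map f) ◁ ψ1 ▷ c.act ⊗≫ φ1 ▷ S.functor.map g ▷ c.act ⊗≫
            S.functor.map a.act ◁ ((S.functor.mapComp f g).inv ≫
              (S.functor.mapComp f g).hom) ▷ c.act ⊗≫
            S.functor.map a.act ◁ S.functor.map f ◁ ψ.cell.hom ⊗≫
            S.functor.map a.act ◁ φ.cell.hom ▷ g ⊗≫ a.assoc.hom ▷ f ▷ g ⊗≫ 𝟙 _ := by
        rw [Iso.inv_hom_id]; bicategory
      _ = _ := by bicategory
  unit_coherence := by
    rw [S.unit_naturality_comp]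
    simp only [Iso.trans_hom, Bicategory.whiskerRightIso_hom, Bicategory.whiskerLeftIso_hom, Iso.symm_hom]
    calc
      _ = 𝟙 (f ≫ g) ⊗≫ f ◁ (𝟙 g ⊗≫ g ◁ c.unit.hom ⊗≫ eqToHom (S.unit_naturality g) ▷ c.act) ⊗≫
          eqToHom (S.unit_naturality f) ▷ (S.functor.map g ≫ c.act) ⊗≫
          S.unit X ◁ ((S.functor.mapComp f g).inv ≫ (S.functor.mapComp f g).hom) ▷ c.act ⊗≫
            (S.unit X ≫ S.functor.map f) ◁ ψ.cell.hom ⊗≫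
          S.unit X ◁ φ.cell.hom ▷ g ⊗≫ 𝟙 _ := by
        bicategory
      _ = 𝟙 (f ≫ g) ⊗≫ f ◁ (𝟙 g ⊗≫ g ◁ c.unit.hom ⊗≫ eqToHom (S.unit_naturality g) ▷ c.act) ⊗≫
          (eqToHom (S.unit_naturality f) ▷ (S.functor.map g ≫ c.act) ≫
            (S.unit X ≫ S.functor.map f) ◁ ψ.cell.hom) ⊗≫
          S.unit X ◁ φ.cell.hom ▷ g ⊗≫ 𝟙 _ := by
        rw [Iso.inv_hom_id]; bicategory
      _ = 𝟙 (f ≫ g) ⊗≫ f ◁ (𝟙 g ⊗≫ g ◁ c.unit.hom ⊗≫ eqToHom (S.unit_naturality g) ▷ c.act ⊗≫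
            S.unit Y ◁ ψ.cell.hom) ⊗≫ eqToHom (S.unit_naturality f) ▷ b.act ▷ g ⊗≫
          S.unit X ◁ φ.cell.hom ▷ g ⊗≫ 𝟙 _ := by
        rw [← whisker_exchange]; bicategory
      _ = 𝟙 (f ≫ g) ⊗≫ (𝟙 f ⊗≫ f ◁ b.unit.hom ⊗≫ eqToHom (S.unit_naturality f) ▷ b.act ⊗≫
            S.unit X ◁ φ.cell.hom) ▷ g ⊗≫ 𝟙 _ := by
        rw [ψ.unit_coherence]; bicategory
      _ = _ := by
        rw [φ.unit_coherence]; bicategory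

end TwoMonads

/-! ### Restriction of a 2-monad along a pseudofunctor, and liftings to pseudoalgebras -/

section Lifting

variable {C : Type u₁} [Bicategory.{w₁, v₁} C] [Strict C]
  {D : Type u₂} [Bicategory.{w₂, v₂} D] [Strict D]

/-- The 2-monad `S` on `D` restricts along `J : C ⥤ᵖ D` to the 2-monad `P` on `C`: `J` is a
morphism of 2-monads from `P` to `S`, where `J P` and `S J` are identified by a pseudonatural
equivalence `app`, and `J` of the unit and multiplication of `P` are identified with the unit and
multiplication of `S` by coherent invertible modifications `unitCell` and `mulCell`.
If `J P = S J` and `J` carries the unit and multiplication of `P` to those of `S` on the nose,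
then `app` is the identity and all the 2-cells below are identities. -/
structure TwoMonad.Restriction (J : C ⥤ᵖ D) (P : TwoMonad C) (S : TwoMonad D) where
  app (X : C) : S.functor.obj (J.obj X) ⟶ J.obj (P.functor.obj X)
  inv (X : C) : J.obj (P.functor.obj X) ⟶ S.functor.obj (J.obj X)
  app_inv (X : C) : app X ≫ inv X ≅ 𝟙 _
  inv_app (X : C) : inv X ≫ app X ≅ 𝟙 _
  /-- the pseudonaturality 2-cells of `app` -/
  nat {X Y : C} (f : X ⟶ Y) :
    S.functor.map (J.map f) ≫ app Y ≅ app X ≫ J.map (P.functor.map f)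
  nat_naturality {X Y : C} {f g : X ⟶ Y} (α : f ⟶ g) :
    S.functor.map₂ (J.map₂ α) ▷ app Y ≫ (nat g).hom =
      (nat f).hom ≫ app X ◁ J.map₂ (P.functor.map₂ α)
  nat_id (X : C) :
    (nat (𝟙 X)).hom ≫ app X ◁ (J.map₂ (P.functor.mapId X).hom ≫ (J.mapId _).hom) =
      (S.functor.map₂ (J.mapId X).hom ≫ (S.functor.mapId _).hom) ▷ app X ≫
        (λ_ (app X)).hom ≫ (ρ_ (app X)).inv
  nat_comp {X Y Z : C} (f : X ⟶ Y) (g : Y ⟶ Z) :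
    (nat (f ≫ g)).hom ≫ app X ◁ (J.map₂ (P.functor.mapComp f g).hom ≫ (J.mapComp _ _).hom) =
      (S.functor.map₂ (J.mapComp f g).hom ≫ (S.functor.mapComp _ _).hom) ▷ app Z ≫
        (α_ _ _ _).hom ≫ S.functor.map (J.map f) ◁ (nat g).hom ≫ (α_ _ _ _).inv ≫
        (nat f).hom ▷ J.map (P.functor.map g) ≫ (α_ _ _ _).hom
  /-- `J` carries the unit of `P` to the unit of `S` -/
  unitCell (X : C) : S.unit (J.obj X) ≫ app X ≅ J.map (P.unit X)
  /-- `J` carries the multiplication of `P` to the multiplication of `S` -/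
  mulCell (X : C) :
    S.mul (J.obj X) ≫ app X ≅
      S.functor.map (app X) ≫ app (P.functor.obj X) ≫ J.map (P.mul X)
  /-- `unitCell` is a modification -/
  unitCell_naturality {X Y : C} (f : X ⟶ Y) :
    J.map f ◁ (unitCell Y).hom ≫ (J.mapComp f (P.unit Y)).inv ≫
        J.map₂ (eqToHom (P.unit_naturality f)) ≫ (J.mapComp (P.unit X) (P.functor.map f)).hom =
      𝟙 _ ⊗≫ eqToHom (S.unit_naturality (J.map f)) ▷ app Y ⊗≫
        S.unit (J.obj X) ◁ (nat f).hom ⊗≫ (unitCell X).hom ▷ J.map (P.functor.map f)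
  /-- `mulCell` is a modification -/
  mulCell_naturality {X Y : C} (f : X ⟶ Y) :
    S.functor.map (S.functor.map (J.map f)) ◁ (mulCell Y).hom ⊗≫
        ((S.functor.mapComp (S.functor.map (J.map f)) (app Y)).inv ≫
          S.functor.map₂ (nat f).hom ≫
          (S.functor.mapComp (app X) (J.map (P.functor.map f))).hom) ▷
            (app (P.functor.obj Y) ≫ J.map (P.mul Y)) ⊗≫
        S.functor.map (app X) ◁ (nat (P.functor.map f)).hom ▷ J.map (P.mul Y) ⊗≫
        S.functor.map (app X) ◁ app (P.functor.obj X) ◁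
          ((J.mapComp (P.functor.map (P.functor.map f)) (P.mul Y)).inv ≫
            J.map₂ (eqToHom (P.mul_naturality f)) ≫
            (J.mapComp (P.mul X) (P.functor.map f)).hom) =
      𝟙 _ ⊗≫ eqToHom (S.mul_naturality (J.map f)) ▷ app Y ⊗≫
        S.mul (J.obj X) ◁ (nat f).hom ⊗≫
        (mulCell X).hom ▷ J.map (P.functor.map f) ⊗≫ 𝟙 _
  /-- compatibility with the law `unit ≫ mul = 𝟙` -/
  unit_mul (X : C) :
    S.unit (S.functor.obj (J.obj X)) ◁ (mulCell X).hom ⊗≫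
        eqToHom (S.unit_naturality (app X)).symm ▷
          (app (P.functor.obj X) ≫ J.map (P.mul X)) ⊗≫
        app X ◁ (unitCell (P.functor.obj X)).hom ▷ J.map (P.mul X) ⊗≫
        app X ◁ ((J.mapComp (P.unit (P.functor.obj X)) (P.mul X)).inv ≫
          J.map₂ (eqToHom (P.unit_mul X)) ≫ (J.mapId (P.functor.obj X)).hom) ⊗≫ 𝟙 (app X) =
      𝟙 _ ⊗≫ eqToHom (S.unit_mul (J.obj X)) ▷ app X ⊗≫ 𝟙 (app X)
  /-- compatibility with the law `map unit ≫ mul = 𝟙` -/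
  map_unit_mul (X : C) :
    S.functor.map (S.unit (J.obj X)) ◁ (mulCell X).hom ⊗≫
        ((S.functor.mapComp (S.unit (J.obj X)) (app X)).inv ≫
          S.functor.map₂ (unitCell X).hom) ▷ (app (P.functor.obj X) ≫ J.map (P.mul X)) ⊗≫
        (nat (P.unit X)).hom ▷ J.map (P.mul X) ⊗≫
        app X ◁ ((J.mapComp (P.functor.map (P.unit X)) (P.mul X)).inv ≫
          J.map₂ (eqToHom (P.map_unit_mul X)) ≫ (J.mapId (P.functor.obj X)).hom) ⊗≫
        𝟙 (app X) =
      𝟙 _ ⊗≫ eqToHom (S.map_unit_mul (J.obj X)) ▷ app X ⊗≫ 𝟙 (app X)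
  /-- compatibility with the law `map mul ≫ mul = mul ≫ mul` -/
  mul_assoc (X : C) :
    S.functor.map (S.mul (J.obj X)) ◁ (mulCell X).hom ⊗≫
        ((S.functor.mapComp (S.mul (J.obj X)) (app X)).inv ≫
          S.functor.map₂ (mulCell X).hom ≫
          (S.functor.mapComp (S.functor.map (app X))
            (app (P.functor.obj X) ≫ J.map (P.mul X))).hom ≫
          S.functor.map (S.functor.map (app X)) ◁
            (S.functor.mapComp (app (P.functor.obj X)) (J.map (P.mul X))).hom) ▷
              (app (P.functor.obj X) ≫ J.map (P.mul X)) ⊗≫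
        S.functor.map (S.functor.map (app X)) ◁ S.functor.map (app (P.functor.obj X)) ◁
          (nat (P.mul X)).hom ▷ J.map (P.mul X) ⊗≫
        S.functor.map (S.functor.map (app X)) ◁ S.functor.map (app (P.functor.obj X)) ◁
          app (P.functor.obj (P.functor.obj X)) ◁
            ((J.mapComp (P.functor.map (P.mul X)) (P.mul X)).inv ≫
              J.map₂ (eqToHom (P.mul_assoc X)) ≫
              (J.mapComp (P.mul (P.functor.obj X)) (P.mul X)).hom) =
      𝟙 _ ⊗≫ eqToHom (S.mul_assoc (J.obj X)) ▷ app X ⊗≫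
        S.mul (S.functor.obj (J.obj X)) ◁ (mulCell X).hom ⊗≫
        eqToHom (S.mul_naturality (app X)).symm ▷
          (app (P.functor.obj X) ≫ J.map (P.mul X)) ⊗≫
        S.functor.map (S.functor.map (app X)) ◁
          (mulCell (P.functor.obj X)).hom ▷ J.map (P.mul X) ⊗≫ 𝟙 _

variable {J : C ⥤ᵖ D} {P : TwoMonad C} {S : TwoMonad D}

/-- The pseudoalgebra structure on `J A` induced by a strict algebra structure on `A`; its
structure map is `S J A ⟶ J P A ⟶ J A`. -/
def TwoMonad.Restriction.alg (r : TwoMonad.Restriction J P S) {A : C} (a : StrictAlgebra P A) :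
    PseudoAlgebraData S (J.obj A) where
  act := r.app A ≫ J.map a.act
  assoc :=
    whiskerRightIso (S.functor.mapComp (r.app A) (J.map a.act)) (r.app A ≫ J.map a.act) ≪≫
      α_ _ _ _ ≪≫
      whiskerLeftIso (S.functor.map (r.app A))
        ((α_ _ _ _).symm ≪≫ whiskerRightIso (r.nat a.act) (J.map a.act) ≪≫ α_ _ _ _ ≪≫
          whiskerLeftIso (r.app (P.functor.obj A))
            ((J.mapComp (P.functor.map a.act) a.act).symm ≪≫ J.map₂Iso (eqToIso a.assoc) ≪≫
              J.mapComp (P.mul A) a.act) ≪≫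
          (α_ _ _ _).symm) ≪≫
      (α_ _ _ _).symm ≪≫ whiskerRightIso (r.mulCell A).symm (J.map a.act) ≪≫ α_ _ _ _
  unit :=
    (J.mapId A).symm ≪≫ J.map₂Iso (eqToIso a.unit.symm) ≪≫ J.mapComp (P.unit A) a.act ≪≫
      whiskerRightIso (r.unitCell A).symm (J.map a.act) ≪≫ α_ _ _ _

/-- A lifting of the relative pseudomonad `T` to pseudoalgebras for `S`: the structure of `T`
lifts to a relative pseudomonad from strict algebras in `C` to pseudoalgebras in `D`. -/
structure PseudoLifting (T : RelPseudomonad J) (r : TwoMonad.Restriction J P S) where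
  alg {A : C} (a : StrictAlgebra P A) : PseudoAlgebra S (T.obj A)
  ext {A B : C} {a : StrictAlgebra P A} {b : StrictAlgebra P B} {f : J.obj A ⟶ T.obj B}
    (φ : PseudoMor (r.alg a) (alg b).toPseudoAlgebraData f) :
    PseudoMor (alg a).toPseudoAlgebraData (alg b).toPseudoAlgebraData (T.ext.obj f)
  unit {A : C} (a : StrictAlgebra P A) :
    PseudoMor (r.alg a) (alg a).toPseudoAlgebraData (T.unit A)
  /-- the extension functors lift to pseudomorphisms and algebra 2-cells -/
  ext_map {A B : C} {a : StrictAlgebra P A} {b : StrictAlgebra P B} {f g : J.obj A ⟶ T.obj B}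
    (φ : PseudoMor (r.alg a) (alg b).toPseudoAlgebraData f)
    (ψ : PseudoMor (r.alg a) (alg b).toPseudoAlgebraData g) (α : f ⟶ g) :
    IsAlgebraCell φ ψ α → IsAlgebraCell (ext φ) (ext ψ) (T.ext.map α)
  mu {A B E : C} {a : StrictAlgebra P A} {b : StrictAlgebra P B} {c : StrictAlgebra P E}
    {f : J.obj A ⟶ T.obj B} {g : J.obj B ⟶ T.obj E}
    (φ : PseudoMor (r.alg a) (alg b).toPseudoAlgebraData f)
    (ψ : PseudoMor (r.alg b) (alg c).toPseudoAlgebraData g) :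
    IsAlgebraCell (ext (φ.comp (ext ψ))) ((ext φ).comp (ext ψ)) (T.mu g f).hom
  eta {A B : C} {a : StrictAlgebra P A} {b : StrictAlgebra P B} {f : J.obj A ⟶ T.obj B}
    (φ : PseudoMor (r.alg a) (alg b).toPseudoAlgebraData f) :
    IsAlgebraCell φ ((unit a).comp (ext φ)) (T.eta f).hom
  theta {A : C} (a : StrictAlgebra P A) :
    IsAlgebraCell (ext (unit a)) (PseudoMor.id (alg a).toPseudoAlgebraData) (T.theta A).hom

/-- The object function, unit and extension functors of the extension of `S` to the Kleisli
bicategory of `T`. On objects it is `X ↦ S X`; the unit at `X` is the composite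
`J X ⟶ S J X ≃ J S X ⟶ T S X` of the units of `S` and `T`; the extension of `f : J X ⟶ T S Y` is
`J S X ≃ S J X ⟶ S T S Y ⟶ T S Y`, the composite of `S f` with the structure map of the
pseudoalgebra `T S Y` lifted from the free algebra `S Y`. -/
def PseudoLifting.kleisliExtension {T : RelPseudomonad J} {r : TwoMonad.Restriction J P S}
    (L : PseudoLifting T r) : KleisliTriple (Pseudofunctor.id (KleisliBicat T)) where
  obj X := ⟨P.functor.obj X.of⟩
  unit X := ((S.unit (J.obj X.of) ≫ r.app X.of) ≫ T.unit (P.functor.obj X.of) :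
    J.obj X.of ⟶ T.obj (P.functor.obj X.of))
  ext {X Y} :=
    { obj := fun (f : J.obj X.of ⟶ T.obj (P.functor.obj Y.of)) =>
        (r.inv X.of ≫ S.functor.map f ≫ (L.alg (P.free Y.of)).act :
          J.obj (P.functor.obj X.of) ⟶ T.obj (P.functor.obj Y.of))
      map := fun {f g : J.obj X.of ⟶ T.obj (P.functor.obj Y.of)} (α : f ⟶ g) =>
        (r.inv X.of ◁ S.functor.map₂ α ▷ (L.alg (P.free Y.of)).act :
          r.inv X.of ≫ S.functor.map f ≫ (L.alg (P.free Y.of)).act ⟶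
            r.inv X.of ≫ S.functor.map g ≫ (L.alg (P.free Y.of)).act)
      map_id := fun (f : J.obj X.of ⟶ T.obj (P.functor.obj Y.of)) => by
        change r.inv X.of ◁ S.functor.map₂ (𝟙 f) ▷ _ = 𝟙 _
        simp
      map_comp := fun {f g h : J.obj X.of ⟶ T.obj (P.functor.obj Y.of)} (α : f ⟶ g)
          (β : g ⟶ h) => by
        change r.inv X.of ◁ S.functor.map₂ (α ≫ β) ▷ _ =
          r.inv X.of ◁ S.functor.map₂ α ▷ _ ≫ r.inv X.of ◁ S.functor.map₂ β ▷ _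
        simp }

end Lifting

section Composite

variable {C : Type u₁} [Bicategory.{w₁, v₁} C] {D : Type u₂} [Bicategory.{w₂, v₂} D]

/-- The data obtained by composing the Kleisli relative pseudoadjunction of `T` with the Kleisli
pseudoadjunction of a pseudomonad `R` (in extension form, that is, relative to the identity) on the
Kleisli bicategory of `T`. A morphism `J X ⟶ T R Y` of `D` is a morphism `X ⟶ R Y` of the Kleisli
bicategory; it is extended first by `R` and then by `T`. -/
def RelPseudomonad.compositeData {J : C ⥤ᵖ D} (T : RelPseudomonad J)
    (R : RelPseudomonad (Pseudofunctor.id (KleisliBicat T))) : RelPseudomonadData J where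
  obj X := T.obj (R.obj ⟨X⟩).of
  unit X := R.unit ⟨X⟩
  ext {X Y} := R.ext (X := ⟨X⟩) (Y := ⟨Y⟩) ⋙ T.ext
  mu {X Y Z} g f :=
    T.ext.mapIso (R.mu (X := ⟨X⟩) (Y := ⟨Y⟩) (Z := ⟨Z⟩) g f) ≪≫ T.mu _ _
  eta {X Y} f := R.eta (X := ⟨X⟩) (Y := ⟨Y⟩) f
  theta X := T.ext.mapIso (R.theta ⟨X⟩) ≪≫ T.theta _

end Composite

/-! ### Algebra 2-cells -/

section AlgebraCells

variable {B : Type u₁} [Bicategory.{w₁, v₁} B] [Strict B] {S : TwoMonad B}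

namespace IsAlgebraCell

variable {X Y Z W : B} {a : PseudoAlgebraData S X} {b : PseudoAlgebraData S Y}
  {c : PseudoAlgebraData S Z} {d : PseudoAlgebraData S W}

/-! The engine is a universal property. Write `u` for the unit `S.unit (J.obj X) ≫ r.app X : J X ⟶ J
P X`. For every pseudoalgebra on `Y`, restriction along `u` is fully faithful on invertible algebra
2-cells between pseudomorphisms `J P X ⟶ Y`, and each `f : J X ⟶ Y` is, up to isomorphism, the
restriction of the pseudomorphism `r.extend b f`. The two halves used are `hom_ext` (algebra 2-cells
that agree on `u` are equal) and `exists_lift` (an invertible 2-cell between restrictions lifts to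
an invertible algebra 2-cell).

For the Kleisli extension, `mu` and `theta` are the lifts of the evident isomorphisms between
restrictions, while `eta` is the isomorphism `f ≅ u ≫ f^S` followed by `T.eta`. Naturality of `eta`
is inherited from `T`. Every other axiom compares two composites of algebra 2-cells, so it may be
tested after restriction along `u`, where the defining isomorphisms cancel and interchange remains.
The lifting enters to show that both sides are algebra 2-cells: it preserves them under `T.ext` and
makes `T.mu` and `T.eta` algebra 2-cells. The composite relative pseudomonad then follows by
applying `T.ext` to the axioms of the extension and using those of `T`.

The universal property is proved first for the free algebra on `S J X`. The extension `S f ≫ act` is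
a pseudomorphism because `act` is one, which requires a unit law absent from the definition of a
pseudoalgebra; `unitLoop_eq_id` derives it from the other axioms. A pseudomorphism `h` is recovered
from its restriction by `freeCounit`, and the triangle identity `unit_whiskerLeft_freeCounit` makes
lifts restrict correctly.

It is carried to `J P X` along the comparison `r.app X`, which is an equivalence and, by the
coherence of the restriction, a pseudomorphism. As `S` preserves equivalences, whiskering with `k`,
`S k` and `S S k` is fully faithful for an equivalence `k`. Hence pseudomorphism structures and
algebra 2-cells descend along `k` (`exists_comp_cell_eq`, `isAlgebraCell_of_whiskerLeft`). -/

theorem comp {f g h : X ⟶ Y} {φ : PseudoMor a b f} {ψ : PseudoMor a b g} {χ : PseudoMor a b h}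
    {α : f ⟶ g} {β : g ⟶ h} (hα : IsAlgebraCell φ ψ α) (hβ : IsAlgebraCell ψ χ β) :
    IsAlgebraCell φ χ (α ≫ β) := by
  simp only [IsAlgebraCell] at *
  simp [hβ, reassoc_of% hα]

theorem symm {f g : X ⟶ Y} {φ : PseudoMor a b f} {ψ : PseudoMor a b g} {e : f ≅ g}
    (h : IsAlgebraCell φ ψ e.hom) : IsAlgebraCell ψ φ e.inv := by
  simp only [IsAlgebraCell] at *
  rw [← cancel_epi (S.functor.map₂ e.hom ▷ b.act), reassoc_of% h]
  simp [← comp_whiskerRight_assoc, ← PrelaxFunctor.map₂_comp, ← Bicategory.whiskerLeft_comp]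

/-- The hypothesis carries `α` past the cell of `ψ`; interchange carries it past the cell of `φ`,
which involves only `f`. -/
theorem whiskerLeft {f : X ⟶ Y} {g g' : Y ⟶ Z} (φ : PseudoMor a b f) {ψ : PseudoMor b c g}
    {ψ' : PseudoMor b c g'} {α : g ⟶ g'} (h : IsAlgebraCell ψ ψ' α) :
    IsAlgebraCell (φ.comp ψ) (φ.comp ψ') (f ◁ α) := by
  simp only [IsAlgebraCell] at *
  simp only [PseudoMor.comp]
  calc
    _ = S.functor.map₂ (f ◁ α) ▷ c.act ≫ (S.functor.mapComp f g').hom ▷ c.act ⊗≫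
        S.functor.map f ◁ ψ'.cell.hom ⊗≫ φ.cell.hom ▷ g' ⊗≫ 𝟙 _ := by simp [bicategoricalComp]
    _ = (S.functor.mapComp f g).hom ▷ c.act ⊗≫ S.functor.map f ◁ (S.functor.map₂ α ▷ c.act ≫
          ψ'.cell.hom) ⊗≫ φ.cell.hom ▷ g' ⊗≫ 𝟙 _ := by simp [bicategoricalComp]
    _ = (S.functor.mapComp f g).hom ▷ c.act ⊗≫ S.functor.map f ◁ ψ.cell.hom ⊗≫
          ((S.functor.map f ≫ b.act) ◁ α ≫ φ.cell.hom ▷ g') ⊗≫ 𝟙 _ := by rw [h]; bicategory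
    _ = _ := by rw [whisker_exchange]; simp [bicategoricalComp]

theorem whiskerRight {f f' : X ⟶ Y} {g : Y ⟶ Z} {φ : PseudoMor a b f} {φ' : PseudoMor a b f'}
    (ψ : PseudoMor b c g) {α : f ⟶ f'} (h : IsAlgebraCell φ φ' α) :
    IsAlgebraCell (φ.comp ψ) (φ'.comp ψ) (α ▷ g) := by
  simp only [IsAlgebraCell] at *
  simp only [PseudoMor.comp]
  calc
    _ = (S.functor.mapComp f g).hom ▷ c.act ⊗≫ (S.functor.map₂ α ▷ (S.functor.map g ≫ c.act) ≫
          S.functor.map f' ◁ ψ.cell.hom) ⊗≫ φ'.cell.hom ▷ g ⊗≫ 𝟙 _ := by simp [bicategoricalComp]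
    _ = (S.functor.mapComp f g).hom ▷ c.act ⊗≫ S.functor.map f ◁ ψ.cell.hom ⊗≫
          (S.functor.map₂ α ▷ b.act ≫ φ'.cell.hom) ▷ g ⊗≫ 𝟙 _ := by
      rw [← whisker_exchange]; bicategory
    _ = _ := by rw [h]; simp [bicategoricalComp]

theorem associator {f : X ⟶ Y} {g : Y ⟶ Z} {h : Z ⟶ W} (φ : PseudoMor a b f)
    (ψ : PseudoMor b c g) (χ : PseudoMor c d h) :
    IsAlgebraCell ((φ.comp ψ).comp χ) (φ.comp (ψ.comp χ)) (α_ f g h).hom := by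
  simp only [IsAlgebraCell]
  simp only [PseudoMor.comp]
  calc
    _ = (S.functor.mapComp (f ≫ g) h).hom ▷ d.act ⊗≫
        (S.functor.mapComp f g).hom ▷ S.functor.map h ▷ d.act ⊗≫
          S.functor.map f ◁ S.functor.map g ◁ χ.cell.hom ⊗≫ S.functor.map f ◁ ψ.cell.hom ▷ h ⊗≫
          φ.cell.hom ▷ g ▷ h ⊗≫ 𝟙 _ := by simp [bicategoricalComp]
    _ = (S.functor.mapComp (f ≫ g) h).hom ▷ d.act ⊗≫
        ((S.functor.mapComp f g).hom ▷ (S.functor.map h ≫ d.act) ≫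
          (S.functor.map f ≫ S.functor.map g) ◁ χ.cell.hom) ⊗≫ S.functor.map f ◁ ψ.cell.hom ▷ h ⊗≫
          φ.cell.hom ▷ g ▷ h ⊗≫ 𝟙 _ := by bicategory
    _ = _ := by rw [← whisker_exchange]; simp [bicategoricalComp]

theorem leftUnitor {f : X ⟶ Y} (φ : PseudoMor a b f) :
    IsAlgebraCell ((PseudoMor.id a).comp φ) φ (λ_ f).hom := by
  simp only [IsAlgebraCell]
  simp only [PseudoMor.comp, PseudoMor.id]
  calc
    _ = (S.functor.mapComp (𝟙 X) f).hom ▷ b.act ⊗≫ ((S.functor.mapId X).hom ▷ (S.functor.map f ≫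
        b.act) ≫ 𝟙 _ ◁ φ.cell.hom) ⊗≫ 𝟙 _ := by simp [bicategoricalComp]
    _ = _ := by rw [← whisker_exchange]; simp [bicategoricalComp]

end IsAlgebraCell

end AlgebraCells

/-! ### Precomposition with an equivalence -/

section Equivalences

variable {B : Type u₁} [Bicategory.{w₁, v₁} B]

/-- No triangle identity is asked of `e` and `e'`: `Equivalence.mk` corrects the unit and counit.
Later arguments use only that whiskering with `k` is full and faithful. -/
theorem precomp_isEquivalence {X Y : B} {k : X ⟶ Y} {l : Y ⟶ X} (e : k ≫ l ≅ 𝟙 X)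
    (e' : l ≫ k ≅ 𝟙 Y) (Z : B) : (precomp Z k).IsEquivalence :=
  (CategoryTheory.Equivalence.mk (precomp Z k) (precomp Z l)
    ((leftUnitorNatIso Y Z).symm ≪≫ (precomposing Y Y Z).mapIso e'.symm ≪≫
      associatorNatIsoRight l k Z)
    ((associatorNatIsoRight k l Z).symm ≪≫ (precomposing X X Z).mapIso e ≪≫
      leftUnitorNatIso X Z)).isEquivalence_functor

theorem whiskerLeft_injective {X Y : B} {k : X ⟶ Y} {l : Y ⟶ X} (e : k ≫ l ≅ 𝟙 X)
    (e' : l ≫ k ≅ 𝟙 Y) {Z : B} {f g : Y ⟶ Z} {α β : f ⟶ g} (h : k ◁ α = k ◁ β) : α = β :=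
  have := precomp_isEquivalence e e' Z
  (precomp Z k).map_injective h

theorem exists_whiskerLeft_eq {X Y : B} {k : X ⟶ Y} {l : Y ⟶ X} (e : k ≫ l ≅ 𝟙 X)
    (e' : l ≫ k ≅ 𝟙 Y) {Z : B} {f g : Y ⟶ Z} (γ : k ≫ f ≅ k ≫ g) :
    ∃ δ : f ≅ g, k ◁ δ.hom = γ.hom :=
  have := precomp_isEquivalence e e' Z
  ⟨(precomp Z k).preimageIso γ, (precomp Z k).map_preimage γ.hom⟩

/-- A pseudofunctor preserves the invertibility of 1-cells up to isomorphism. -/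
def mapCompIsoId {E : Type u₂} [Bicategory.{w₂, v₂} E] (F : B ⥤ᵖ E) {X Y : B} {k : X ⟶ Y}
    {l : Y ⟶ X} (e : k ≫ l ≅ 𝟙 X) : F.map k ≫ F.map l ≅ 𝟙 (F.obj X) :=
  (F.mapComp k l).symm ≪≫ F.map₂Iso e ≪≫ F.mapId X

end Equivalences

/-! ### Transport of pseudomorphisms -/

section Transport

variable {B : Type u₁} [Bicategory.{w₁, v₁} B] [Strict B] {S : TwoMonad B}
  {X Y Z : B} {a : PseudoAlgebraData S X} {b : PseudoAlgebraData S Y} {c : PseudoAlgebraData S Z}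

namespace PseudoMor

/-- Transport of a pseudomorphism structure along an invertible 2-cell. -/
def ofIso {f g : X ⟶ Y} (φ : PseudoMor a b f) (e : f ≅ g) : PseudoMor a b g where
  cell := whiskerRightIso (S.functor.map₂Iso e.symm) b.act ≪≫ φ.cell ≪≫ whiskerLeftIso a.act e
  assoc_coherence := by
    -- Applying `S` to the conjugated cell conjugates `S` of the original cell, so the axiom for `g`
    -- becomes the axiom for `f` conjugated by `e`.
    have h1 : (S.functor.mapComp (S.functor.map g) b.act).inv ≫
        S.functor.map₂ (S.functor.map₂ e.inv ▷ b.act ≫ φ.cell.hom ≫ a.act ◁ e.hom) ≫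
          (S.functor.mapComp a.act g).hom =
        S.functor.map₂ (S.functor.map₂ e.inv) ▷ S.functor.map b.act ≫
          ((S.functor.mapComp (S.functor.map f) b.act).inv ≫ S.functor.map₂ φ.cell.hom ≫
            (S.functor.mapComp a.act f).hom) ≫ S.functor.map a.act ◁ S.functor.map₂ e.hom := by
      simp
    have h2 := S.mul_naturality₂ e.inv
    simp only [Iso.trans_hom, whiskerRightIso_hom, whiskerLeftIso_hom, PrelaxFunctor.map₂Iso_hom,
      Iso.symm_hom]
    rw [h1]
    have key := φ.assoc_coherence
    revert key
    generalize (S.functor.mapComp (S.functor.map f) b.act).inv ≫ S.functor.map₂ φ.cell.hom ≫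
            (S.functor.mapComp a.act f).hom = φ₁
    intro key
    calc
      _ = S.functor.map (S.functor.map g) ◁ b.assoc.hom ⊗≫
          (eqToHom (S.mul_naturality g) ≫ S.mul X ◁ S.functor.map₂ e.inv) ▷ b.act ⊗≫
          S.mul X ◁ φ.cell.hom ⊗≫ S.mul X ◁ a.act ◁ e.hom := by bicategory
      _ = (S.functor.map (S.functor.map g) ◁ b.assoc.hom ≫
          S.functor.map₂ (S.functor.map₂ e.inv) ▷ (S.mul Y ≫ b.act)) ⊗≫
          eqToHom (S.mul_naturality f) ▷ b.act ⊗≫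
          S.mul X ◁ φ.cell.hom ⊗≫ S.mul X ◁ a.act ◁ e.hom := by rw [← h2]; bicategory
      _ = S.functor.map₂ (S.functor.map₂ e.inv) ▷ (S.functor.map b.act ≫ b.act) ⊗≫
          (S.functor.map (S.functor.map f) ◁ b.assoc.hom ⊗≫
          eqToHom (S.mul_naturality f) ▷ b.act ⊗≫
          S.mul X ◁ φ.cell.hom) ⊗≫ S.mul X ◁ a.act ◁ e.hom := by
        rw [whisker_exchange]; bicategory
      _ = 𝟙 _ ⊗≫ S.functor.map₂ (S.functor.map₂ e.inv) ▷ S.functor.map b.act ▷ b.act ⊗≫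
          φ₁ ▷ b.act ⊗≫ S.functor.map a.act ◁ φ.cell.hom ⊗≫
          (a.assoc.hom ▷ f ≫ (S.mul X ≫ a.act) ◁ e.hom) ⊗≫ 𝟙 _ := by
        rw [key]; bicategory
      -- The identity on `S f` marks the place where `S e.hom ≫ S e.inv` is inserted next: the first
      -- factor completes the inner conjugated cell, the second belongs to the outer one.
      _ = 𝟙 _ ⊗≫ S.functor.map₂ (S.functor.map₂ e.inv) ▷ S.functor.map b.act ▷ b.act ⊗≫
          φ₁ ▷ b.act ⊗≫ S.functor.map a.act ◁ (𝟙 (S.functor.map f) ▷ b.act ≫ φ.cell.hom ≫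
            a.act ◁ e.hom) ⊗≫ a.assoc.hom ▷ g ⊗≫ 𝟙 _ := by
        rw [← whisker_exchange]; bicategory
      _ = _ := by
        rw [← S.functor.map₂_id, ← e.hom_inv_id, S.functor.map₂_comp]; bicategory
  unit_coherence := by
    have h2 := S.unit_naturality₂ e.inv
    simp only [Iso.trans_hom, whiskerRightIso_hom, whiskerLeftIso_hom, PrelaxFunctor.map₂Iso_hom,
      Iso.symm_hom]
    calc
      _ = 𝟙 g ⊗≫ g ◁ b.unit.hom ⊗≫
          (eqToHom (S.unit_naturality g) ≫ S.unit X ◁ S.functor.map₂ e.inv) ▷ b.act ⊗≫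
          S.unit X ◁ φ.cell.hom ⊗≫ S.unit X ◁ a.act ◁ e.hom := by bicategory
      _ = 𝟙 g ⊗≫ (g ◁ b.unit.hom ≫ e.inv ▷ (S.unit Y ≫ b.act)) ⊗≫
          eqToHom (S.unit_naturality f) ▷ b.act ⊗≫
          S.unit X ◁ φ.cell.hom ⊗≫ S.unit X ◁ a.act ◁ e.hom := by rw [← h2]; bicategory
      _ = 𝟙 g ⊗≫ e.inv ⊗≫ (𝟙 f ⊗≫ f ◁ b.unit.hom ⊗≫
          eqToHom (S.unit_naturality f) ▷ b.act ⊗≫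
          S.unit X ◁ φ.cell.hom) ⊗≫ S.unit X ◁ a.act ◁ e.hom := by
        rw [whisker_exchange]; bicategory
      _ = 𝟙 g ⊗≫ e.inv ⊗≫ (a.unit.hom ▷ f ≫ (S.unit X ≫ a.act) ◁ e.hom) ⊗≫ 𝟙 _ := by
        rw [φ.unit_coherence]; bicategory
      _ = 𝟙 g ⊗≫ (e.inv ≫ e.hom) ⊗≫ a.unit.hom ▷ g ⊗≫ 𝟙 _ := by
        rw [← whisker_exchange]; bicategory
      _ = _ := by rw [e.inv_hom_id]; bicategory

theorem isAlgebraCell_ofIso {f g : X ⟶ Y} (φ : PseudoMor a b f) (e : f ≅ g) :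
    IsAlgebraCell φ (φ.ofIso e) e.hom := by
  simp only [IsAlgebraCell, ofIso, Iso.trans_hom, whiskerRightIso_hom, whiskerLeftIso_hom,
    PrelaxFunctor.map₂Iso_hom, Iso.symm_hom]
  rw [← comp_whiskerRight_assoc, ← S.functor.map₂_comp, e.hom_inv_id]
  simp

/-- The 2-cell of a composite pseudomorphism. -/
def compCell {f : X ⟶ Y} {g : Y ⟶ Z} (φ : S.functor.map f ≫ b.act ≅ a.act ≫ f)
    (ψ : S.functor.map g ≫ c.act ≅ b.act ≫ g) : S.functor.map (f ≫ g) ≫ c.act ≅ a.act ≫ f ≫ g :=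
  whiskerRightIso (S.functor.mapComp f g) c.act ≪≫ α_ _ _ _ ≪≫
    whiskerLeftIso (S.functor.map f) ψ ≪≫ (α_ _ _ _).symm ≪≫ whiskerRightIso φ g ≪≫ α_ _ _ _

/-- Modulo the axiom for `φ`, each side of the axiom for `χ` is `S S f` whiskered with the
corresponding side of the axiom wanted for `ψ`, pasted with the same invertible cells. Cancelling
these cells leaves the whiskered axiom. -/
theorem assoc_coherence_of_comp {f : X ⟶ Y} {g : Y ⟶ Z} (φ : PseudoMor a b f)
    (ψ : S.functor.map g ≫ c.act ≅ b.act ≫ g) (χ : PseudoMor a c (f ≫ g))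
    (h : χ.cell = compCell φ.cell ψ) :
    S.functor.map (S.functor.map f) ◁ (S.functor.map (S.functor.map g) ◁ c.assoc.hom ⊗≫
        eqToHom (S.mul_naturality g) ▷ c.act ⊗≫ S.mul Y ◁ ψ.hom) =
      S.functor.map (S.functor.map f) ◁ (𝟙 _ ⊗≫
        ((S.functor.mapComp (S.functor.map g) c.act).inv ≫ S.functor.map₂ ψ.hom ≫
          (S.functor.mapComp b.act g).hom) ▷ c.act ⊗≫
        S.functor.map b.act ◁ ψ.hom ⊗≫ b.assoc.hom ▷ g ⊗≫ 𝟙 (S.mul Y ≫ b.act ≫ g)) := by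
  have key := χ.assoc_coherence
  have hφ := φ.assoc_coherence
  rw [h, S.mul_naturality_comp] at key
  simp only [compCell, Iso.trans_hom, whiskerRightIso_hom, whiskerLeftIso_hom, Iso.symm_hom] at key
  have h1 : (S.functor.mapComp _ _).inv ≫ S.functor.map₂ ((S.functor.mapComp f g).hom ▷ c.act ≫
      (α_ _ _ _).hom ≫ S.functor.map f ◁ ψ.hom ≫ (α_ _ _ _).inv ≫ φ.cell.hom ▷ g ≫
        (α_ _ _ _).hom) ≫ (S.functor.mapComp a.act (f ≫ g)).hom =
        (S.functor.map₂ (S.functor.mapComp f g).hom ≫ (S.functor.mapComp _ _).hom) ▷ _ ≫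
        (α_ _ _ _).hom ≫ _ ◁ ((S.functor.mapComp (S.functor.map g) c.act).inv ≫
          S.functor.map₂ ψ.hom ≫ (S.functor.mapComp b.act g).hom) ≫ (α_ _ _ _).inv ≫
        ((S.functor.mapComp (S.functor.map f) b.act).inv ≫
          S.functor.map₂ φ.cell.hom ≫ (S.functor.mapComp a.act f).hom) ▷ _ ≫
        (α_ _ _ _).hom ≫ S.functor.map a.act ◁ (S.functor.mapComp f g).inv := by
    have h2 : S.functor.map₂ (α_ (S.functor.map f) b.act g).inv =
        (S.functor.mapComp _ _).hom ≫ _ ◁ (S.functor.mapComp _ _).hom ≫ (α_ _ _ _).inv ≫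
          (S.functor.mapComp _ _).inv ▷ _ ≫ (S.functor.mapComp _ _).inv := by
      rw [S.functor.mapComp_assoc_right_hom_assoc]
      simp
    simp [h2]
  rw [h1] at key
  -- Recorded before `k` becomes opaque, so that `k` can be cancelled at the end.
  have hk : IsIso (S.functor.map₂ (S.functor.mapComp f g).hom ≫
    (S.functor.mapComp (S.functor.map f) (S.functor.map g)).hom) := inferInstance
  revert key hφ hk
  generalize S.functor.map₂ (S.functor.mapComp f g).hom ≫ (S.functor.mapComp _ _).hom = k
  generalize (S.functor.mapComp (S.functor.map g) c.act).inv ≫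
          S.functor.map₂ ψ.hom ≫ (S.functor.mapComp b.act g).hom = ψ₁
  generalize (S.functor.mapComp (S.functor.map f) b.act).inv ≫
          S.functor.map₂ φ.cell.hom ≫ (S.functor.mapComp a.act f).hom = φ₁
  intro hφ key hk
  -- both sides of `key` are `SSf ◁ _` up to composition with invertible 2-cells
  have hl : k ▷ (S.functor.map c.act ≫ c.act) ⊗≫ S.functor.map (S.functor.map f) ◁
      (S.functor.map (S.functor.map g) ◁ c.assoc.hom ⊗≫
        eqToHom (S.mul_naturality g) ▷ c.act ⊗≫ S.mul Y ◁ ψ.hom) ⊗≫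
      eqToHom (S.mul_naturality f) ▷ b.act ▷ g ⊗≫ S.mul X ◁ φ.cell.hom ▷ g ⊗≫
        𝟙 ((S.mul X ≫ a.act) ≫ f ≫ g) =
      k ▷ (S.functor.map c.act ≫ c.act) ⊗≫ S.functor.map (S.functor.map f) ◁
        (𝟙 (S.functor.map (S.functor.map g) ≫ S.functor.map c.act ≫ c.act) ⊗≫ ψ₁ ▷ c.act ⊗≫
          S.functor.map b.act ◁ ψ.hom ⊗≫ b.assoc.hom ▷ g ⊗≫ 𝟙 (S.mul Y ≫ b.act ≫ g)) ⊗≫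
      eqToHom (S.mul_naturality f) ▷ b.act ▷ g ⊗≫ S.mul X ◁ φ.cell.hom ▷ g ⊗≫
        𝟙 ((S.mul X ≫ a.act) ≫ f ≫ g) := by
    -- The trailing identity 2-cell rebrackets the common target of `key` to the one in `hl`.
    refine Eq.trans ?_
      ((congrArg (fun t => t ⊗≫ 𝟙 ((S.mul X ≫ a.act) ≫ f ≫ g)) key).trans ?_)
    · symm
      calc
        _ = (S.functor.map (S.functor.map (f ≫ g)) ◁ c.assoc.hom ≫ k ▷ (S.mul Z ≫ c.act)) ⊗≫
            S.functor.map (S.functor.map f) ◁ eqToHom (S.mul_naturality g) ▷ c.act ⊗≫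
            eqToHom (S.mul_naturality f) ▷ S.functor.map g ▷ c.act ⊗≫
            S.mul X ◁ ((S.functor.mapComp f g).inv ≫ (S.functor.mapComp f g).hom) ▷ c.act ⊗≫
            S.mul X ◁ S.functor.map f ◁ ψ.hom ⊗≫ S.mul X ◁ φ.cell.hom ▷ g ⊗≫ 𝟙 _ := by
          bicategory
        _ = k ▷ (S.functor.map c.act ≫ c.act) ⊗≫ S.functor.map (S.functor.map f) ◁
              S.functor.map (S.functor.map g) ◁ c.assoc.hom ⊗≫
            S.functor.map (S.functor.map f) ◁ eqToHom (S.mul_naturality g) ▷ c.act ⊗≫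
            (eqToHom (S.mul_naturality f) ▷ (S.functor.map g ≫ c.act) ≫
              (S.mul X ≫ S.functor.map f) ◁ ψ.hom) ⊗≫ S.mul X ◁ φ.cell.hom ▷ g ⊗≫ 𝟙 _ := by
          rw [whisker_exchange, Iso.inv_hom_id]; bicategory
        _ = _ := by rw [← whisker_exchange]; bicategory
    · calc
        _ = 𝟙 _ ⊗≫ k ▷ (S.functor.map c.act ≫ c.act) ⊗≫
              S.functor.map (S.functor.map f) ◁ ψ₁ ▷ c.act ⊗≫ φ₁ ▷ S.functor.map g ▷ c.act ⊗≫
              S.functor.map a.act ◁ ((S.functor.mapComp f g).inv ≫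
                (S.functor.mapComp f g).hom) ▷ c.act ⊗≫
              S.functor.map a.act ◁ S.functor.map f ◁ ψ.hom ⊗≫
              S.functor.map a.act ◁ φ.cell.hom ▷ g ⊗≫ a.assoc.hom ▷ f ▷ g ⊗≫ 𝟙 _ := by
          bicategory
        _ = k ▷ (S.functor.map c.act ≫ c.act) ⊗≫
              S.functor.map (S.functor.map f) ◁ ψ₁ ▷ c.act ⊗≫
              (φ₁ ▷ (S.functor.map g ≫ c.act) ≫
                (S.functor.map a.act ≫ S.functor.map f) ◁ ψ.hom) ⊗≫
              S.functor.map a.act ◁ φ.cell.hom ▷ g ⊗≫ a.assoc.hom ▷ f ▷ g ⊗≫ 𝟙 _ := by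
          rw [Iso.inv_hom_id]; bicategory
        _ = k ▷ (S.functor.map c.act ≫ c.act) ⊗≫
              S.functor.map (S.functor.map f) ◁ ψ₁ ▷ c.act ⊗≫
              S.functor.map (S.functor.map f) ◁ S.functor.map b.act ◁ ψ.hom ⊗≫
              (𝟙 (S.functor.map (S.functor.map f) ≫ S.functor.map b.act ≫ b.act) ⊗≫
                φ₁ ▷ b.act ⊗≫ S.functor.map a.act ◁ φ.cell.hom ⊗≫
                a.assoc.hom ▷ f ⊗≫ 𝟙 (S.mul X ≫ a.act ≫ f)) ▷ g ⊗≫ 𝟙 _ := by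
          rw [← whisker_exchange]; bicategory
        _ = _ := by rw [← hφ]; bicategory
  revert hl
  generalize (S.functor.map (S.functor.map g) ◁ c.assoc.hom ⊗≫
        eqToHom (S.mul_naturality g) ▷ c.act ⊗≫ S.mul Y ◁ ψ.hom) = x
  generalize (𝟙 (S.functor.map (S.functor.map g) ≫ S.functor.map c.act ≫ c.act) ⊗≫ ψ₁ ▷ c.act ⊗≫
      S.functor.map b.act ◁ ψ.hom ⊗≫ b.assoc.hom ▷ g ⊗≫
    𝟙 (S.mul Y ≫ b.act ≫ g)) = y
  intro hl
  simpa [bicategoricalComp, cancel_epi, cancel_mono] using hl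

/-- The same cancellation for the unit axiom; here the whiskering is with `f` itself, since the
axiom starts at `g` rather than at `S S g`. -/
theorem unit_coherence_of_comp {f : X ⟶ Y} {g : Y ⟶ Z} (φ : PseudoMor a b f)
    (ψ : S.functor.map g ≫ c.act ≅ b.act ≫ g) (χ : PseudoMor a c (f ≫ g))
    (h : χ.cell = compCell φ.cell ψ) :
    f ◁ (𝟙 g ⊗≫ g ◁ c.unit.hom ⊗≫ eqToHom (S.unit_naturality g) ▷ c.act ⊗≫
        S.unit Y ◁ ψ.hom) =
      f ◁ (𝟙 g ⊗≫ b.unit.hom ▷ g ⊗≫ 𝟙 (S.unit Y ≫ b.act ≫ g)) := by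
  have key := χ.unit_coherence
  have hφ := φ.unit_coherence
  rw [h, S.unit_naturality_comp] at key
  simp only [compCell, Iso.trans_hom, whiskerRightIso_hom, whiskerLeftIso_hom, Iso.symm_hom] at key
  have hl : f ◁ (𝟙 g ⊗≫ g ◁ c.unit.hom ⊗≫ eqToHom (S.unit_naturality g) ▷ c.act ⊗≫
        S.unit Y ◁ ψ.hom) ⊗≫ eqToHom (S.unit_naturality f) ▷ b.act ▷ g ⊗≫
          S.unit X ◁ φ.cell.hom ▷ g ⊗≫ 𝟙 ((S.unit X ≫ a.act) ≫ f ≫ g) =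
      f ◁ (𝟙 g ⊗≫ b.unit.hom ▷ g ⊗≫ 𝟙 (S.unit Y ≫ b.act ≫ g)) ⊗≫
          eqToHom (S.unit_naturality f) ▷ b.act ▷ g ⊗≫
          S.unit X ◁ φ.cell.hom ▷ g ⊗≫ 𝟙 ((S.unit X ≫ a.act) ≫ f ≫ g) := by
    have e₁ : f ◁ (𝟙 g ⊗≫ g ◁ c.unit.hom ⊗≫ eqToHom (S.unit_naturality g) ▷ c.act ⊗≫
        S.unit Y ◁ ψ.hom) ⊗≫ eqToHom (S.unit_naturality f) ▷ b.act ▷ g ⊗≫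
          S.unit X ◁ φ.cell.hom ▷ g ⊗≫ 𝟙 ((S.unit X ≫ a.act) ≫ f ≫ g) =
        𝟙 _ ⊗≫ (f ≫ g) ◁ c.unit.hom ⊗≫ f ◁ eqToHom (S.unit_naturality g) ▷ c.act ⊗≫
          eqToHom (S.unit_naturality f) ▷ S.functor.map g ▷ c.act ⊗≫
          S.unit X ◁ ((S.functor.mapComp f g).inv ≫ (S.functor.mapComp f g).hom) ▷ c.act ⊗≫
          S.unit X ◁ S.functor.map f ◁ ψ.hom ⊗≫ S.unit X ◁ φ.cell.hom ▷ g ⊗≫ 𝟙 _ := by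
      rw [Iso.inv_hom_id]
      calc
        _ = 𝟙 _ ⊗≫ (f ≫ g) ◁ c.unit.hom ⊗≫ f ◁ eqToHom (S.unit_naturality g) ▷ c.act ⊗≫
            ((f ≫ S.unit Y) ◁ ψ.hom ≫ eqToHom (S.unit_naturality f) ▷ (b.act ≫ g)) ⊗≫
            S.unit X ◁ φ.cell.hom ▷ g ⊗≫ 𝟙 _ := by bicategory
        _ = _ := by rw [whisker_exchange]; bicategory
    have e₂ : f ◁ (𝟙 g ⊗≫ b.unit.hom ▷ g ⊗≫ 𝟙 (S.unit Y ≫ b.act ≫ g)) ⊗≫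
          eqToHom (S.unit_naturality f) ▷ b.act ▷ g ⊗≫
          S.unit X ◁ φ.cell.hom ▷ g ⊗≫ 𝟙 ((S.unit X ≫ a.act) ≫ f ≫ g) =
        𝟙 _ ⊗≫ (𝟙 f ⊗≫ f ◁ b.unit.hom ⊗≫ eqToHom (S.unit_naturality f) ▷ b.act ⊗≫
          S.unit X ◁ φ.cell.hom) ▷ g ⊗≫ 𝟙 _ := by bicategory
    rw [e₁, e₂, hφ]
    refine Eq.trans ?_
      ((congrArg (fun t => t ⊗≫ 𝟙 ((S.unit X ≫ a.act) ≫ f ≫ g)) key).trans ?_) <;> bicategory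
  revert hl
  generalize (𝟙 g ⊗≫ g ◁ c.unit.hom ⊗≫ eqToHom (S.unit_naturality g) ▷ c.act ⊗≫
    S.unit Y ◁ ψ.hom) = x
  generalize (𝟙 g ⊗≫ b.unit.hom ▷ g ⊗≫ 𝟙 (S.unit Y ≫ b.act ≫ g)) = y
  intro hl
  simpa [bicategoricalComp, cancel_epi, cancel_mono] using hl

/-- If a pseudomorphism structure on a composite `k ≫ g` with an equivalence `k` comes from
a 2-cell on `g`, then this 2-cell is a pseudomorphism structure on `g`. -/
def ofComp {k : X ⟶ Y} {l : Y ⟶ X} {g : Y ⟶ Z} (κ : PseudoMor a b k) (e : k ≫ l ≅ 𝟙 X)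
    (e' : l ≫ k ≅ 𝟙 Y) (ψ : S.functor.map g ≫ c.act ≅ b.act ≫ g) (χ : PseudoMor a c (k ≫ g))
    (h : χ.cell = compCell κ.cell ψ) : PseudoMor b c g where
  cell := ψ
  -- The associativity axiom is known after whiskering with `S S k`, which is an equivalence because
  -- `S` is applied twice to `e` and `e'`.
  assoc_coherence := whiskerLeft_injective
    (mapCompIsoId S.functor.toPseudofunctor (mapCompIsoId S.functor.toPseudofunctor e))
    (mapCompIsoId S.functor.toPseudofunctor (mapCompIsoId S.functor.toPseudofunctor e'))
    (assoc_coherence_of_comp κ ψ χ h)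
  unit_coherence := whiskerLeft_injective e e' (unit_coherence_of_comp κ ψ χ h)

/-- Every pseudomorphism structure on the composite `k ≫ g` with a pseudomorphism `k` which is an
equivalence comes from a pseudomorphism structure on `g`. -/
theorem exists_comp_cell_eq {k : X ⟶ Y} {l : Y ⟶ X} {g : Y ⟶ Z} (κ : PseudoMor a b k)
    (e : k ≫ l ≅ 𝟙 X) (e' : l ≫ k ≅ 𝟙 Y) (χ : PseudoMor a c (k ≫ g)) :
    ∃ ψ : PseudoMor b c g, χ.cell = (κ.comp ψ).cell := by
  -- The equation `χ.cell = compCell κ.cell ψ` is solved for `S k ◁ ψ`, and fullness of whiskering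
  -- with `S k` provides `ψ`.
  obtain ⟨ψ, hψ⟩ := exists_whiskerLeft_eq (mapCompIsoId S.functor.toPseudofunctor e)
    (mapCompIsoId S.functor.toPseudofunctor e') ((α_ _ _ _).symm ≪≫
      (whiskerRightIso (S.functor.mapComp k g) c.act).symm ≪≫ χ.cell ≪≫ (α_ _ _ _).symm ≪≫
      (whiskerRightIso κ.cell g).symm ≪≫ α_ _ _ _)
  have h : χ.cell = compCell κ.cell ψ := by
    ext
    simp [compCell, hψ]
  exact ⟨ofComp κ e e' ψ χ h, h⟩

end PseudoMor

/-- Converse of `IsAlgebraCell.whiskerLeft` when `k` is an equivalence: once `mapComp` and the cell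
of `κ` are cancelled, the hypothesis is the desired equation whiskered with `S k`. -/
theorem isAlgebraCell_of_whiskerLeft {k : X ⟶ Y} {l : Y ⟶ X} {f g : Y ⟶ Z} {κ : PseudoMor a b k}
    (e : k ≫ l ≅ 𝟙 X) (e' : l ≫ k ≅ 𝟙 Y) {φ : PseudoMor b c f} {ψ : PseudoMor b c g}
    {α : f ⟶ g} (h : IsAlgebraCell (κ.comp φ) (κ.comp ψ) (k ◁ α)) : IsAlgebraCell φ ψ α := by
  refine whiskerLeft_injective (mapCompIsoId S.functor.toPseudofunctor e)
    (mapCompIsoId S.functor.toPseudofunctor e') ?_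
  simp only [IsAlgebraCell, PseudoMor.comp, Iso.trans_hom, whiskerRightIso_hom,
    whiskerLeftIso_hom, Iso.symm_hom] at h
  have h' : (S.functor.mapComp k f).hom ▷ c.act ⊗≫
      S.functor.map k ◁ (S.functor.map₂ α ▷ c.act ≫ ψ.cell.hom) ⊗≫ κ.cell.hom ▷ g ⊗≫
        𝟙 (a.act ≫ k ≫ g) =
      (S.functor.mapComp k f).hom ▷ c.act ⊗≫
      S.functor.map k ◁ (φ.cell.hom ≫ b.act ◁ α) ⊗≫ κ.cell.hom ▷ g ⊗≫ 𝟙 (a.act ≫ k ≫ g) := by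
    calc
      _ = _ := by simp [bicategoricalComp]
      _ = _ := h
      _ = (S.functor.mapComp k f).hom ▷ c.act ⊗≫ S.functor.map k ◁ φ.cell.hom ⊗≫
          (κ.cell.hom ▷ f ≫ (a.act ≫ k) ◁ α) ⊗≫ 𝟙 _ := by bicategory
      _ = _ := by rw [← whisker_exchange]; bicategory
  revert h'
  generalize S.functor.map₂ α ▷ c.act ≫ ψ.cell.hom = x
  generalize φ.cell.hom ≫ b.act ◁ α = y
  intro h'
  simpa [bicategoricalComp, cancel_epi, cancel_mono] using h'

end Transport

/-- Solved for `F.map₂`, so that `simp` can push `F` through a pasting that contains this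
constraint. -/
theorem CategoryTheory.Pseudofunctor.map₂_associator_inv' {B : Type u₁} [Bicategory.{w₁, v₁} B]
    {E : Type u₂} [Bicategory.{w₂, v₂} E] (F : B ⥤ᵖ E) {W X Y Z : B} (f : W ⟶ X) (g : X ⟶ Y)
    (h : Y ⟶ Z) : F.map₂ (α_ f g h).inv = (F.mapComp f (g ≫ h)).hom ≫
      F.map f ◁ (F.mapComp g h).hom ≫ (α_ _ _ _).inv ≫ (F.mapComp f g).inv ▷ F.map h ≫
        (F.mapComp (f ≫ g) h).inv := by
  rw [F.mapComp_assoc_right_hom_assoc]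
  simp

theorem CategoryTheory.Pseudofunctor.map₂_rightUnitor_inv' {B : Type u₁} [Bicategory.{w₁, v₁} B]
    {E : Type u₂} [Bicategory.{w₂, v₂} E] (F : B ⥤ᵖ E) {X Y : B} (f : X ⟶ Y) :
    F.map₂ (ρ_ f).inv = (ρ_ (F.map f)).inv ≫ F.map f ◁ (F.mapId Y).inv ≫
      (F.mapComp f (𝟙 Y)).inv := by
  rw [F.mapComp_id_right_inv]
  simp

/-! ### Free algebras -/

section Free

variable {B : Type u₁} [Bicategory.{w₁, v₁} B] [Strict B] {S : TwoMonad B}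

/-- The pseudoalgebra data underlying the free algebra. -/
def TwoMonad.freeData (S : TwoMonad B) (Z : B) : PseudoAlgebraData S (S.functor.obj Z) where
  act := S.mul Z
  assoc := eqToIso (S.mul_assoc Z)
  unit := eqToIso (S.unit_mul Z).symm

/-! ### The derived unit law of a pseudoalgebra. -/

namespace PseudoAlgebra

variable {Y : B} (b : PseudoAlgebra S Y)

/-- The endomorphism of the structure map which the second unit law of a pseudoalgebra asserts to
be the identity. -/
def unitLoop : b.act ⟶ b.act :=
  𝟙 b.act ⊗≫ b.act ◁ b.unit.hom ⊗≫ eqToHom (S.unit_naturality b.act) ▷ b.act ⊗≫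
    S.unit (S.functor.obj Y) ◁ b.assoc.hom ⊗≫ eqToHom (S.unit_mul Y) ▷ b.act ⊗≫ 𝟙 b.act

/-- Paste with the invertible `assoc`. The associativity axiom trades `S assoc` followed by `assoc`
for two unprimed uses of `assoc`; the assumed unit law absorbs one of these together with `S unit`.
What remains is `assoc` and equality 2-cells from the monad laws, which cancel. -/
theorem map₂_unitLoop : S.functor.map₂ b.unitLoop ▷ b.act = 𝟙 _ := by
  have hA := b.assoc_coherence
  have hU := b.unit_coherence
  have hΛ : S.functor.map₂ b.unitLoop = 𝟙 _ ⊗≫ S.functor.map b.act ◁ ((S.functor.mapId Y).inv ≫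
        S.functor.map₂ b.unit.hom ≫ (S.functor.mapComp (S.unit Y) b.act).hom) ⊗≫
      ((S.functor.mapComp _ _).inv ≫ S.functor.map₂ (eqToHom (S.unit_naturality b.act)) ≫
        (S.functor.mapComp _ _).hom) ▷ S.functor.map b.act ⊗≫
      S.functor.map (S.unit (S.functor.obj Y)) ◁
        ((S.functor.mapComp (S.functor.map b.act) b.act).inv ≫ S.functor.map₂ b.assoc.hom ≫
          (S.functor.mapComp (S.mul Y) b.act).hom) ⊗≫
      ((S.functor.mapComp _ _).inv ≫ S.functor.map₂ (eqToHom (S.unit_mul Y)) ≫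
        (S.functor.mapId _).hom) ▷ S.functor.map b.act ⊗≫ 𝟙 _ := by
    unfold unitLoop
    generalize eqToHom (S.unit_naturality b.act) = n
    generalize eqToHom (S.unit_mul Y) = w
    simp [bicategoricalComp, Pseudofunctor.map₂_associator_inv',
      Pseudofunctor.map₂_rightUnitor_inv']
  -- The universally quantified `n` lets the equation survive the later `generalize`, after which it
  -- is specialised to the opaque cell. The identity itself holds between equality 2-cells; the same
  -- device serves for `hw`.
  have hn : ∀ n, n = ((S.functor.mapComp _ _).inv ≫
      S.functor.map₂ (eqToHom (S.unit_naturality b.act)) ≫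
        (S.functor.mapComp _ _).hom) →
      S.functor.map b.act ◁ eqToHom (S.map_unit_mul Y).symm ⊗≫ n ▷ S.mul Y ⊗≫
        S.functor.map (S.unit _) ◁ eqToHom (S.mul_naturality b.act) =
      𝟙 _ ⊗≫ eqToHom (S.map_unit_mul _).symm ▷ S.functor.map b.act ⊗≫ 𝟙 _ := by
    rintro _ rfl
    simp [bicategoricalComp, Strict.associator_eqToIso, Strict.leftUnitor_eqToIso,
      Strict.rightUnitor_eqToIso, StrictPseudofunctor.mapComp_eq_eqToIso,
      PrelaxFunctor.map₂_eqToHom]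
  have hw : ∀ w, w = ((S.functor.mapComp _ _).inv ≫ S.functor.map₂ (eqToHom (S.unit_mul Y)) ≫
        (S.functor.mapId _).hom) →
      S.functor.map (S.unit _) ◁ eqToHom (S.mul_assoc Y).symm ⊗≫ w ▷ S.mul Y ⊗≫
        𝟙 (S.mul Y) =
      𝟙 _ ⊗≫ eqToHom (S.map_unit_mul _) ▷ S.mul Y ⊗≫ 𝟙 _ := by
    rintro _ rfl
    simp [bicategoricalComp, Strict.associator_eqToIso, Strict.leftUnitor_eqToIso,
      StrictPseudofunctor.mapComp_eq_eqToIso, StrictlyUnitaryPseudofunctor.mapId_eq_eqToIso,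
          PrelaxFunctor.map₂_eqToHom]
  rw [hΛ]
  revert hn hw hA hU
  generalize ((S.functor.mapComp _ _).inv ≫ S.functor.map₂ (eqToHom (S.unit_naturality b.act)) ≫
        (S.functor.mapComp _ _).hom) = n
  generalize ((S.functor.mapComp _ _).inv ≫ S.functor.map₂ (eqToHom (S.unit_mul Y)) ≫
        (S.functor.mapId _).hom) = w
  generalize ((S.functor.mapId Y).inv ≫
        S.functor.map₂ b.unit.hom ≫ (S.functor.mapComp (S.unit Y) b.act).hom) = U
  generalize ((S.functor.mapComp (S.functor.map b.act) b.act).inv ≫ S.functor.map₂ b.assoc.hom ≫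
          (S.functor.mapComp (S.mul Y) b.act).hom) = A
  intro hA hU hn hw
  replace hn := hn n rfl
  replace hw := hw w rfl
  rw [← cancel_mono b.assoc.hom]
  -- The associativity axiom, and in `hU'` the unit axiom, with the equality 2-cell moved to the
  -- other side so that it can be used as a replacement rule.
  have hA' : A ▷ b.act ⊗≫ S.functor.map (S.mul Y) ◁ b.assoc.hom =
      𝟙 _ ⊗≫ S.functor.map (S.functor.map b.act) ◁ b.assoc.hom ⊗≫
      eqToHom (S.mul_naturality b.act) ▷ b.act ⊗≫ S.mul (S.functor.obj Y) ◁ b.assoc.hom ⊗≫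
      eqToHom (S.mul_assoc Y).symm ▷ b.act ⊗≫ 𝟙 _ := by
    calc
      _ = (𝟙 _ ⊗≫ A ▷ b.act ⊗≫ S.functor.map (S.mul Y) ◁ b.assoc.hom) ⊗≫
          (eqToHom (S.mul_assoc Y) ≫ eqToHom (S.mul_assoc Y).symm) ▷ b.act ⊗≫ 𝟙 _ := by
        rw [eqToHom_trans, eqToHom_refl]; bicategory
      _ = 𝟙 _ ⊗≫ (𝟙 (S.functor.map (S.functor.map b.act) ≫ S.functor.map b.act ≫ b.act) ⊗≫
          A ▷ b.act ⊗≫ S.functor.map (S.mul Y) ◁ b.assoc.hom ⊗≫ eqToHom (S.mul_assoc Y) ▷ b.act ⊗≫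
              𝟙 (S.mul (S.functor.obj Y) ≫ S.mul Y ≫ b.act)) ⊗≫
            eqToHom (S.mul_assoc Y).symm ▷ b.act ⊗≫ 𝟙 _ := by
        bicategory
      _ = _ := by rw [← hA]; bicategory
  have hU' : U ▷ b.act ⊗≫ S.functor.map (S.unit Y) ◁ b.assoc.hom =
      𝟙 _ ⊗≫ eqToHom (S.map_unit_mul Y).symm ▷ b.act ⊗≫ 𝟙 _ := by
    calc
      _ = U ▷ b.act ⊗≫ S.functor.map (S.unit Y) ◁ b.assoc.hom ⊗≫
          (eqToHom (S.map_unit_mul Y) ≫ eqToHom (S.map_unit_mul Y).symm) ▷ b.act ⊗≫ 𝟙 _ := by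
        rw [eqToHom_trans, eqToHom_refl]; bicategory
      _ = 𝟙 _ ⊗≫ (𝟙 b.act ⊗≫ U ▷ b.act ⊗≫ S.functor.map (S.unit Y) ◁ b.assoc.hom ⊗≫
          eqToHom (S.map_unit_mul Y) ▷ b.act ⊗≫ 𝟙 b.act) ⊗≫
            eqToHom (S.map_unit_mul Y).symm ▷ b.act ⊗≫ 𝟙 _ := by
        bicategory
      _ = _ := by rw [hU]; bicategory
  calc
    _ = 𝟙 _ ⊗≫ S.functor.map b.act ◁ U ▷ b.act ⊗≫ n ▷ S.functor.map b.act ▷ b.act ⊗≫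
        S.functor.map (S.unit (S.functor.obj Y)) ◁ A ▷ b.act ⊗≫
        (w ▷ (S.functor.map b.act ≫ b.act) ≫ 𝟙 _ ◁ b.assoc.hom) ⊗≫ 𝟙 _ := by bicategory
    _ = 𝟙 _ ⊗≫ S.functor.map b.act ◁ U ▷ b.act ⊗≫ n ▷ S.functor.map b.act ▷ b.act ⊗≫
        S.functor.map (S.unit (S.functor.obj Y)) ◁ (A ▷ b.act ⊗≫
          S.functor.map (S.mul Y) ◁ b.assoc.hom) ⊗≫ w ▷ S.mul Y ▷ b.act ⊗≫ 𝟙 _ := by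
      rw [← whisker_exchange]; bicategory
    _ = 𝟙 _ ⊗≫ S.functor.map b.act ◁ U ▷ b.act ⊗≫ (n ▷ (S.functor.map b.act ≫ b.act) ≫
          (S.functor.map (S.unit (S.functor.obj Y)) ≫ S.functor.map (S.functor.map b.act)) ◁
            b.assoc.hom) ⊗≫
        S.functor.map (S.unit (S.functor.obj Y)) ◁ eqToHom (S.mul_naturality b.act) ▷ b.act ⊗≫
        S.functor.map (S.unit (S.functor.obj Y)) ◁ S.mul (S.functor.obj Y) ◁ b.assoc.hom ⊗≫
        S.functor.map (S.unit (S.functor.obj Y)) ◁ eqToHom (S.mul_assoc Y).symm ▷ b.act ⊗≫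
        w ▷ S.mul Y ▷ b.act ⊗≫ 𝟙 _ := by
      rw [hA']; bicategory
    _ = 𝟙 _ ⊗≫ S.functor.map b.act ◁ (U ▷ b.act ⊗≫ S.functor.map (S.unit Y) ◁ b.assoc.hom) ⊗≫
        n ▷ S.mul Y ▷ b.act ⊗≫
        S.functor.map (S.unit (S.functor.obj Y)) ◁ eqToHom (S.mul_naturality b.act) ▷ b.act ⊗≫
        S.functor.map (S.unit (S.functor.obj Y)) ◁ S.mul (S.functor.obj Y) ◁ b.assoc.hom ⊗≫
        (S.functor.map (S.unit (S.functor.obj Y)) ◁ eqToHom (S.mul_assoc Y).symm ⊗≫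
        w ▷ S.mul Y ⊗≫ 𝟙 (S.mul Y)) ▷ b.act ⊗≫ 𝟙 _ := by
      rw [← whisker_exchange]; bicategory
    _ = 𝟙 _ ⊗≫ (S.functor.map b.act ◁ eqToHom (S.map_unit_mul Y).symm ⊗≫ n ▷ S.mul Y ⊗≫
        S.functor.map (S.unit _) ◁ eqToHom (S.mul_naturality b.act)) ▷ b.act ⊗≫
        S.functor.map (S.unit (S.functor.obj Y)) ◁ S.mul (S.functor.obj Y) ◁ b.assoc.hom ⊗≫
        eqToHom (S.map_unit_mul _) ▷ S.mul Y ▷ b.act ⊗≫ 𝟙 _ := by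
      rw [hU', hw]; bicategory
    _ = 𝟙 _ ⊗≫ (eqToHom (S.map_unit_mul (S.functor.obj Y)).symm ▷ (S.functor.map b.act ≫ b.act) ≫
        (S.functor.map (S.unit (S.functor.obj Y)) ≫ S.mul (S.functor.obj Y)) ◁ b.assoc.hom) ⊗≫
        eqToHom (S.map_unit_mul _) ▷ S.mul Y ▷ b.act ⊗≫ 𝟙 _ := by
      rw [hn]; bicategory
    _ = 𝟙 _ ⊗≫ b.assoc.hom ⊗≫ (eqToHom (S.map_unit_mul (S.functor.obj Y)).symm ≫
        eqToHom (S.map_unit_mul _)) ▷ S.mul Y ▷ b.act ⊗≫ 𝟙 _ := by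
      rw [← whisker_exchange]; bicategory
    _ = _ := by
      rw [eqToHom_trans, eqToHom_refl]; bicategory

/-- By 2-naturality of `S.unit`, whiskering `unitLoop` with `unit ≫ act` amounts to whiskering `S
unitLoop ▷ act` with the unit, and the latter cell is trivial by `map₂_unitLoop`. So `unitLoop`
followed by the invertible `b.act ◁ b.unit.hom` equals that cell alone. -/
theorem unitLoop_eq_id : b.unitLoop = 𝟙 b.act := by
  have h := b.map₂_unitLoop
  have hn := S.unit_naturality₂ b.unitLoop
  have h' : 𝟙 _ ⊗≫ b.unitLoop ⊗≫ b.act ◁ b.unit.hom = 𝟙 b.act ⊗≫ b.act ◁ b.unit.hom := by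
    calc
      _ = 𝟙 _ ⊗≫ (b.unitLoop ▷ 𝟙 _ ≫ b.act ◁ b.unit.hom) := by bicategory
      _ = 𝟙 _ ⊗≫ b.act ◁ b.unit.hom ⊗≫ b.unitLoop ▷ S.unit Y ▷ b.act ⊗≫
          (eqToHom (S.unit_naturality b.act) ≫ eqToHom (S.unit_naturality b.act).symm) ▷ b.act ⊗≫
          𝟙 _ := by
        rw [← whisker_exchange, eqToHom_trans, eqToHom_refl]; bicategory
      _ = 𝟙 _ ⊗≫ b.act ◁ b.unit.hom ⊗≫ (b.unitLoop ▷ S.unit Y ≫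
          eqToHom (S.unit_naturality b.act)) ▷ b.act ⊗≫
            eqToHom (S.unit_naturality b.act).symm ▷ b.act ⊗≫ 𝟙 _ := by
        bicategory
      _ = 𝟙 _ ⊗≫ b.act ◁ b.unit.hom ⊗≫ eqToHom (S.unit_naturality b.act) ▷ b.act ⊗≫
          S.unit _ ◁ (S.functor.map₂ b.unitLoop ▷ b.act) ⊗≫
            eqToHom (S.unit_naturality b.act).symm ▷ b.act ⊗≫ 𝟙 _ := by
        rw [hn]; bicategory
      _ = 𝟙 _ ⊗≫ b.act ◁ b.unit.hom ⊗≫ (eqToHom (S.unit_naturality b.act) ≫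
            eqToHom (S.unit_naturality b.act).symm) ▷ b.act ⊗≫ 𝟙 _ := by
        rw [h]; bicategory
      _ = _ := by rw [eqToHom_trans, eqToHom_refl]; bicategory
  rw [← cancel_mono ((ρ_ b.act).inv ≫ b.act ◁ b.unit.hom)]
  simpa [bicategoricalComp] using h'

/-- The second unit law of a pseudoalgebra. -/
theorem unit_coherence' :
    𝟙 b.act ⊗≫ b.act ◁ b.unit.hom ⊗≫ eqToHom (S.unit_naturality b.act) ▷ b.act ⊗≫
      S.unit (S.functor.obj Y) ◁ b.assoc.hom =
    𝟙 b.act ⊗≫ eqToHom (S.unit_mul Y).symm ▷ b.act ⊗≫ 𝟙 _ := by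
  have h := b.unitLoop_eq_id
  calc
    _ = (𝟙 b.act ⊗≫ b.act ◁ b.unit.hom ⊗≫ eqToHom (S.unit_naturality b.act) ▷ b.act ⊗≫
      S.unit (S.functor.obj Y) ◁ b.assoc.hom) ⊗≫ (eqToHom (S.unit_mul Y) ≫
        eqToHom (S.unit_mul Y).symm) ▷ b.act ⊗≫ 𝟙 _ := by
      rw [eqToHom_trans, eqToHom_refl]; bicategory
    _ = b.unitLoop ⊗≫ eqToHom (S.unit_mul Y).symm ▷ b.act ⊗≫ 𝟙 _ := by
      unfold unitLoop; bicategory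
    _ = _ := by rw [h]

/-- The structure map of a pseudoalgebra is a pseudomorphism from the free algebra. -/
def actMor : PseudoMor (S.freeData Y) b.toPseudoAlgebraData b.act where
  cell := b.assoc
  assoc_coherence := b.assoc_coherence
  unit_coherence := b.unit_coherence'

end PseudoAlgebra

/-! ### Strict morphisms between free algebras. -/

namespace TwoMonad

variable (S) in
/-- The strict morphism of free algebras `S f`. -/
def freeMap {Y Z : B} (f : Y ⟶ Z) : PseudoMor (S.freeData Y) (S.freeData Z) (S.functor.map f) where
  cell := eqToIso (S.mul_naturality f)
  assoc_coherence := by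
    -- Every 2-cell here reduces to an `eqToHom` by strictness, so the two sides agree as parallel
    -- equality 2-cells.
    simp only [bicategoricalComp, BicategoricalCoherence.iso]
    simp [freeData, Strict.associator_eqToIso,
      StrictPseudofunctor.mapComp_eq_eqToIso, PrelaxFunctor.map₂_eqToHom]
  unit_coherence := by
    simp only [bicategoricalComp, BicategoricalCoherence.iso]
    simp [freeData, Strict.associator_eqToIso, Strict.leftUnitor_eqToIso,
      Strict.rightUnitor_eqToIso]

variable (S) in
/-- The multiplication, a strict morphism of free algebras. -/
def freeMul (Z : B) : PseudoMor (S.freeData (S.functor.obj Z)) (S.freeData Z) (S.mul Z) where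
  cell := eqToIso (S.mul_assoc Z)
  assoc_coherence := by
    simp only [bicategoricalComp, BicategoricalCoherence.iso]
    simp [freeData, Strict.associator_eqToIso,
      StrictPseudofunctor.mapComp_eq_eqToIso, PrelaxFunctor.map₂_eqToHom]
  unit_coherence := by
    simp only [bicategoricalComp, BicategoricalCoherence.iso]
    simp [freeData, Strict.associator_eqToIso, Strict.leftUnitor_eqToIso,
      Strict.rightUnitor_eqToIso]

theorem isAlgebraCell_freeMap {Y Z : B} {f g : Y ⟶ Z} (α : f ⟶ g) :
    IsAlgebraCell (S.freeMap f) (S.freeMap g) (S.functor.map₂ α) :=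
  S.mul_naturality₂ α

theorem isAlgebraCell_mapComp {X Y Z : B} (f : X ⟶ Y) (g : Y ⟶ Z) :
    IsAlgebraCell (S.freeMap (f ≫ g)) ((S.freeMap f).comp (S.freeMap g))
      (S.functor.mapComp f g).hom := by
  simp [IsAlgebraCell, PseudoMor.comp, freeMap, freeData, Strict.associator_eqToIso,
      StrictPseudofunctor.mapComp_eq_eqToIso, PrelaxFunctor.map₂_eqToHom]

theorem isAlgebraCell_map_unit_mul (Z : B) :
    IsAlgebraCell ((S.freeMap (S.unit Z)).comp (S.freeMul Z)) (PseudoMor.id (S.freeData Z))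
      (eqToHom (S.map_unit_mul Z)) := by
  simp [IsAlgebraCell, PseudoMor.comp, PseudoMor.id, freeMap, freeMul, freeData,
    Strict.associator_eqToIso, Strict.leftUnitor_eqToIso, Strict.rightUnitor_eqToIso,
    StrictPseudofunctor.mapComp_eq_eqToIso, StrictlyUnitaryPseudofunctor.mapId_eq_eqToIso,
    PrelaxFunctor.map₂_eqToHom]

end TwoMonad

/-! ### The universal property of the free algebra. -/

namespace PseudoAlgebra

variable {Y Z : B} (b : PseudoAlgebra S Y)

/-- The extension of `f : Z ⟶ Y` to a pseudomorphism from the free algebra on `Z`. -/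
def freeExt (f : Z ⟶ Y) :
    PseudoMor (S.freeData Z) b.toPseudoAlgebraData (S.functor.map f ≫ b.act) :=
  (S.freeMap f).comp b.actMor

theorem isAlgebraCell_freeExt {f g : Z ⟶ Y} (α : f ⟶ g) :
    IsAlgebraCell (b.freeExt f) (b.freeExt g) (S.functor.map₂ α ▷ b.act) :=
  (TwoMonad.isAlgebraCell_freeMap α).whiskerRight _

/-- The restriction of the extension of `f` along the unit is `f`. -/
def freeUnit (f : Z ⟶ Y) : S.unit Z ≫ S.functor.map f ≫ b.act ≅ f :=
  (α_ _ _ _).symm ≪≫ whiskerRightIso (eqToIso (S.unit_naturality f).symm) b.act ≪≫ α_ _ _ _ ≪≫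
    whiskerLeftIso f b.unit.symm ≪≫ ρ_ f

theorem freeUnit_naturality {f g : Z ⟶ Y} (α : f ⟶ g) :
    S.unit Z ◁ S.functor.map₂ α ▷ b.act ≫ (b.freeUnit g).hom = (b.freeUnit f).hom ≫ α := by
  have h := S.unit_naturality₂ α
  have h' : S.unit Z ◁ S.functor.map₂ α ≫ eqToHom (S.unit_naturality g).symm =
      eqToHom (S.unit_naturality f).symm ≫ α ▷ S.unit Y := by
    rw [← cancel_epi (eqToHom (S.unit_naturality f)), ← cancel_mono (eqToHom (S.unit_naturality g))]
    simpa using h.symm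
  simp only [freeUnit, Iso.trans_hom, whiskerRightIso_hom, whiskerLeftIso_hom, Iso.symm_hom,
    eqToIso.hom]
  calc
    _ = 𝟙 _ ⊗≫ (S.unit Z ◁ S.functor.map₂ α ≫ eqToHom (S.unit_naturality g).symm) ▷ b.act ⊗≫
        g ◁ b.unit.inv ⊗≫ 𝟙 _ := by bicategory
    _ = 𝟙 _ ⊗≫ eqToHom (S.unit_naturality f).symm ▷ b.act ⊗≫ (α ▷ (S.unit Y ≫ b.act) ≫
        g ◁ b.unit.inv) ⊗≫ 𝟙 _ := by rw [h']; bicategory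
    _ = _ := by rw [← whisker_exchange]; bicategory

variable {b}

/-- The 2-cell of a pseudomorphism from a free algebra. -/
def freeCell {h : S.functor.obj Z ⟶ Y} (φ : PseudoMor (S.freeData Z) b.toPseudoAlgebraData h) :
    S.functor.map h ≫ b.act ≅ S.mul Z ≫ h :=
  φ.cell

/-- The axiom of `φ` with the data of `S.freeData` unfolded, so that `S.mul` and the equality
2-cells are visible to rewriting. -/
theorem freeCell_assoc_coherence {h : S.functor.obj Z ⟶ Y}
    (φ : PseudoMor (S.freeData Z) b.toPseudoAlgebraData h) :
    S.functor.map (S.functor.map h) ◁ b.assoc.hom ⊗≫ eqToHom (S.mul_naturality h) ▷ b.act ⊗≫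
        S.mul (S.functor.obj Z) ◁ (freeCell φ).hom =
      𝟙 _ ⊗≫ ((S.functor.mapComp (S.functor.map h) b.act).inv ≫
          S.functor.map₂ (freeCell φ).hom ≫ (S.functor.mapComp (S.mul Z) h).hom) ▷ b.act ⊗≫
        S.functor.map (S.mul Z) ◁ (freeCell φ).hom ⊗≫ eqToHom (S.mul_assoc Z) ▷ h ⊗≫ 𝟙 _ :=
  φ.assoc_coherence

theorem freeCell_unit_coherence {h : S.functor.obj Z ⟶ Y}
    (φ : PseudoMor (S.freeData Z) b.toPseudoAlgebraData h) :
    𝟙 h ⊗≫ h ◁ b.unit.hom ⊗≫ eqToHom (S.unit_naturality h) ▷ b.act ⊗≫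
        S.unit (S.functor.obj Z) ◁ (freeCell φ).hom =
      𝟙 h ⊗≫ eqToHom (S.unit_mul Z).symm ▷ h ⊗≫ 𝟙 _ :=
  φ.unit_coherence

/-- A pseudomorphism from a free algebra is the extension of its restriction along the unit. -/
def freeCounit {h : S.functor.obj Z ⟶ Y} (φ : PseudoMor (S.freeData Z) b.toPseudoAlgebraData h) :
    S.functor.map (S.unit Z ≫ h) ≫ b.act ≅ h :=
  whiskerRightIso (S.functor.mapComp (S.unit Z) h) b.act ≪≫ α_ _ _ _ ≪≫
    whiskerLeftIso (S.functor.map (S.unit Z)) (freeCell φ) ≪≫ (α_ _ _ _).symm ≪≫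
    whiskerRightIso (eqToIso (S.map_unit_mul Z)) h ≪≫ λ_ h

/-- Each factor of `freeCounit` is an algebra 2-cell: `mapComp`, the constraints, the unit law of
the monad, and the whiskered cell of `φ`. -/
theorem isAlgebraCell_freeCounit {h : S.functor.obj Z ⟶ Y}
    (φ : PseudoMor (S.freeData Z) b.toPseudoAlgebraData h) :
    IsAlgebraCell (b.freeExt (S.unit Z ≫ h)) φ (freeCounit φ).hom := by
  refine .comp (ψ := ((S.freeMap (S.unit Z)).comp (S.freeMap h)).comp b.actMor)
    ((TwoMonad.isAlgebraCell_mapComp _ _).whiskerRight _) ?_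
  refine .comp (.associator _ _ _) ?_
  -- That the cell of `φ` is itself an algebra 2-cell is the associativity axiom of `φ`.
  have h₁ : IsAlgebraCell ((S.freeMap h).comp b.actMor) ((S.freeMul Z).comp φ) φ.cell.hom := by
    change S.functor.map₂ (freeCell φ).hom ▷ b.act ≫ (S.functor.mapComp (S.mul Z) h).hom ▷ b.act ≫
      (α_ _ _ _).hom ≫ S.functor.map (S.mul Z) ◁ (freeCell φ).hom ≫ (α_ _ _ _).inv ≫
        eqToHom (S.mul_assoc Z) ▷ h ≫ (α_ _ _ _).hom =
      ((S.functor.mapComp (S.functor.map h) b.act).hom ▷ b.act ≫ (α_ _ _ _).hom ≫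
        S.functor.map (S.functor.map h) ◁ b.assoc.hom ≫ (α_ _ _ _).inv ≫
          eqToHom (S.mul_naturality h) ▷ b.act ≫ (α_ _ _ _).hom) ≫
        S.mul (S.functor.obj Z) ◁ (freeCell φ).hom
    rw [← cancel_epi ((S.functor.mapComp (S.functor.map h) b.act).inv ▷ b.act)]
    calc
      _ = 𝟙 _ ⊗≫ (𝟙 (S.functor.map (S.functor.map h) ≫ S.functor.map b.act ≫ b.act) ⊗≫
          ((S.functor.mapComp (S.functor.map h) b.act).inv ≫
          S.functor.map₂ (freeCell φ).hom ≫ (S.functor.mapComp (S.mul Z) h).hom) ▷ b.act ⊗≫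
          S.functor.map (S.mul Z) ◁ (freeCell φ).hom ⊗≫ eqToHom (S.mul_assoc Z) ▷ h ⊗≫
            𝟙 (S.mul (S.functor.obj Z) ≫ S.mul Z ≫ h)) := by bicategory
      _ = _ := by
        rw [← freeCell_assoc_coherence φ, ← cancel_epi
          ((S.functor.mapComp (S.functor.map h) b.act).hom ▷ b.act)]
        simp [bicategoricalComp]
  refine .comp (h₁.whiskerLeft _) ?_
  refine .comp (IsAlgebraCell.associator _ _ _).symm ?_
  exact .comp ((TwoMonad.isAlgebraCell_map_unit_mul Z).whiskerRight _) (.leftUnitor _)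

theorem freeCounit_naturality {h k : S.functor.obj Z ⟶ Y}
    {φ : PseudoMor (S.freeData Z) b.toPseudoAlgebraData h}
    {ψ : PseudoMor (S.freeData Z) b.toPseudoAlgebraData k} {α : h ⟶ k}
    (hα : IsAlgebraCell φ ψ α) :
    S.functor.map₂ (S.unit Z ◁ α) ▷ b.act ≫ (freeCounit ψ).hom = (freeCounit φ).hom ≫ α := by
  simp only [freeCounit, Iso.trans_hom, whiskerRightIso_hom, whiskerLeftIso_hom, Iso.symm_hom,
    eqToIso.hom]
  calc
    _ = (S.functor.mapComp (S.unit Z) h).hom ▷ b.act ⊗≫ S.functor.map (S.unit Z) ◁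
        (S.functor.map₂ α ▷ b.act ≫ (freeCell ψ).hom) ⊗≫ eqToHom (S.map_unit_mul Z) ▷ k ⊗≫ 𝟙 _ := by
      simp [bicategoricalComp]
    _ = (S.functor.mapComp (S.unit Z) h).hom ▷ b.act ⊗≫
        S.functor.map (S.unit Z) ◁ (freeCell φ).hom ⊗≫
        ((S.functor.map (S.unit Z) ≫ S.mul Z) ◁ α ≫ eqToHom (S.map_unit_mul Z) ▷ k) ⊗≫ 𝟙 _ := by
      have hα' : S.functor.map₂ α ▷ b.act ≫ (freeCell ψ).hom = (freeCell φ).hom ≫ S.mul Z ◁ α := hα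
      rw [hα']; simp [bicategoricalComp]
    _ = _ := by rw [whisker_exchange]; simp [bicategoricalComp]

/-- A triangle identity between `freeUnit` and `freeCounit`. After interchange it is the unit axiom
of `φ`, up to a loop of equality 2-cells given by the monad laws. -/
theorem unit_whiskerLeft_freeCounit {h : S.functor.obj Z ⟶ Y}
    (φ : PseudoMor (S.freeData Z) b.toPseudoAlgebraData h) :
    S.unit Z ◁ (freeCounit φ).hom = (b.freeUnit (S.unit Z ≫ h)).hom := by
  have key := freeCell_unit_coherence φ
  have he : S.unit Z ◁ eqToHom (S.unit_mul Z).symm ⊗≫ eqToHom (S.unit_naturality (S.unit Z)) ▷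
      S.mul Z ⊗≫ S.unit Z ◁ eqToHom (S.map_unit_mul Z) = 𝟙 _ := by
    simp [bicategoricalComp, Strict.associator_eqToIso]
  rw [← cancel_epi (b.freeUnit (S.unit Z ≫ h)).inv, Iso.inv_hom_id]
  simp only [freeUnit, freeCounit, Iso.trans_hom, Iso.trans_inv, whiskerRightIso_hom,
    whiskerRightIso_inv, whiskerLeftIso_hom, whiskerLeftIso_inv, Iso.symm_hom, Iso.symm_inv,
    eqToIso.hom, eqToIso.inv]
  rw [S.unit_naturality_comp]
  generalize (freeCell φ).hom = p at key ⊢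
  calc
    _ = 𝟙 _ ⊗≫ S.unit Z ◁ h ◁ b.unit.hom ⊗≫ S.unit Z ◁ eqToHom (S.unit_naturality h) ▷ b.act ⊗≫
        eqToHom (S.unit_naturality (S.unit Z)) ▷ S.functor.map h ▷ b.act ⊗≫
        S.unit Z ◁ ((S.functor.mapComp (S.unit Z) h).inv ≫
          (S.functor.mapComp (S.unit Z) h).hom) ▷ b.act ⊗≫
        S.unit Z ◁ S.functor.map (S.unit Z) ◁ p ⊗≫ S.unit Z ◁ eqToHom (S.map_unit_mul Z) ▷ h ⊗≫
        𝟙 _ := by bicategory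
    _ = 𝟙 _ ⊗≫ S.unit Z ◁ h ◁ b.unit.hom ⊗≫ S.unit Z ◁ eqToHom (S.unit_naturality h) ▷ b.act ⊗≫
        (eqToHom (S.unit_naturality (S.unit Z)) ▷ (S.functor.map h ≫ b.act) ≫
          (S.unit Z ≫ S.functor.map (S.unit Z)) ◁ p) ⊗≫
        S.unit Z ◁ eqToHom (S.map_unit_mul Z) ▷ h ⊗≫ 𝟙 _ := by
      rw [Iso.inv_hom_id]; bicategory
    _ = 𝟙 _ ⊗≫ S.unit Z ◁ (𝟙 h ⊗≫ h ◁ b.unit.hom ⊗≫ eqToHom (S.unit_naturality h) ▷ b.act ⊗≫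
          S.unit (S.functor.obj Z) ◁ p) ⊗≫
        eqToHom (S.unit_naturality (S.unit Z)) ▷ S.mul Z ▷ h ⊗≫
        S.unit Z ◁ eqToHom (S.map_unit_mul Z) ▷ h ⊗≫ 𝟙 _ := by
      rw [← whisker_exchange]; bicategory
    _ = 𝟙 _ ⊗≫ (S.unit Z ◁ eqToHom (S.unit_mul Z).symm ⊗≫
        eqToHom (S.unit_naturality (S.unit Z)) ▷ S.mul Z ⊗≫
          S.unit Z ◁ eqToHom (S.map_unit_mul Z)) ▷ h ⊗≫ 𝟙 _ := by
      rw [key]; bicategory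
    _ = _ := by rw [he]; bicategory

/-- Algebra 2-cells between pseudomorphisms from a free algebra are determined by their restriction
along the unit. -/
theorem free_ext {h k : S.functor.obj Z ⟶ Y}
    {φ : PseudoMor (S.freeData Z) b.toPseudoAlgebraData h}
    {ψ : PseudoMor (S.freeData Z) b.toPseudoAlgebraData k} {α β : h ⟶ k}
    (hα : IsAlgebraCell φ ψ α) (hβ : IsAlgebraCell φ ψ β)
    (e : S.unit Z ◁ α = S.unit Z ◁ β) : α = β := by
  -- Naturality of `freeCounit` expresses an algebra 2-cell through its restriction along the unit.
  rw [← cancel_epi (freeCounit φ).hom, ← freeCounit_naturality hα, ← freeCounit_naturality hβ, e]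

/-- Every invertible 2-cell between the restrictions of two pseudomorphisms from a free algebra
along the unit is the restriction of an algebra 2-cell. -/
theorem exists_free_lift {h k : S.functor.obj Z ⟶ Y}
    (φ : PseudoMor (S.freeData Z) b.toPseudoAlgebraData h)
    (ψ : PseudoMor (S.freeData Z) b.toPseudoAlgebraData k) (γ : S.unit Z ≫ h ≅ S.unit Z ≫ k) :
    ∃ δ : h ≅ k, IsAlgebraCell φ ψ δ.hom ∧ S.unit Z ◁ δ.hom = γ.hom := by
  -- The lift is the free extension of `γ` conjugated by the counits; the triangle identity turns
  -- its restriction into `γ` conjugated by `freeUnit`, and naturality finishes.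
  refine ⟨(freeCounit φ).symm ≪≫ whiskerRightIso (S.functor.map₂Iso γ) b.act ≪≫ freeCounit ψ,
    (isAlgebraCell_freeCounit φ).symm.comp
      ((b.isAlgebraCell_freeExt γ.hom).comp (isAlgebraCell_freeCounit ψ)), ?_⟩
  have h₁ : S.unit Z ◁ (freeCounit φ).inv = (b.freeUnit (S.unit Z ≫ h)).inv := by
    rw [← cancel_mono (b.freeUnit (S.unit Z ≫ h)).hom, ← unit_whiskerLeft_freeCounit φ,
      ← Bicategory.whiskerLeft_comp, unit_whiskerLeft_freeCounit φ]
    simp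
  simp only [Iso.trans_hom, Iso.symm_hom, whiskerRightIso_hom, Bicategory.whiskerLeft_comp, h₁,
    unit_whiskerLeft_freeCounit, PrelaxFunctor.map₂Iso_hom]
  rw [freeUnit_naturality, Iso.inv_hom_id_assoc]

end PseudoAlgebra

end Free

/-! ### Pseudomorphisms out of `J P X` -/

section RestrictedFree

variable {C : Type u₁} [Bicategory.{w₁, v₁} C] [Strict C]
  {D : Type u₂} [Bicategory.{w₂, v₂} D] [Strict D]
  {J : C ⥤ᵖ D} {P : TwoMonad C} {S : TwoMonad D}

namespace TwoMonad.Restriction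

variable (r : TwoMonad.Restriction J P S)

/-- This is `r.mul_assoc` rearranged into the associativity axiom of the pseudomorphism `r.app X`.
The cell of that pseudomorphism is the inverse of `mulCell`, so every occurrence of `mulCell` is
moved across the equation. -/
theorem mulCell_assoc_coherence (X : C) :
    S.functor.map (S.functor.map (r.app X)) ◁
        ((S.functor.mapComp (r.app (P.functor.obj X)) (J.map (P.mul X))).hom ▷
            (r.app (P.functor.obj X) ≫ J.map (P.mul X)) ≫ (α_ _ _ _).hom ≫
          S.functor.map (r.app (P.functor.obj X)) ◁ ((α_ _ _ _).inv ≫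
            (r.nat (P.mul X)).hom ▷ J.map (P.mul X) ≫ (α_ _ _ _).hom ≫
            r.app (P.functor.obj (P.functor.obj X)) ◁
              ((J.mapComp (P.functor.map (P.mul X)) (P.mul X)).inv ≫
                J.map₂ (eqToHom (P.mul_assoc X)) ≫
                (J.mapComp (P.mul (P.functor.obj X)) (P.mul X)).hom) ≫ (α_ _ _ _).inv) ≫
          (α_ _ _ _).inv ≫ (r.mulCell (P.functor.obj X)).inv ▷ J.map (P.mul X) ≫ (α_ _ _ _).hom) ⊗≫
        eqToHom (S.mul_naturality (r.app X)) ▷ (r.app (P.functor.obj X) ≫ J.map (P.mul X)) ⊗≫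
        S.mul (S.functor.obj (J.obj X)) ◁ (r.mulCell X).inv =
      𝟙 _ ⊗≫ ((S.functor.mapComp (S.functor.map (r.app X))
            (r.app (P.functor.obj X) ≫ J.map (P.mul X))).inv ≫
          S.functor.map₂ (r.mulCell X).inv ≫
          (S.functor.mapComp (S.mul (J.obj X)) (r.app X)).hom) ▷
            (r.app (P.functor.obj X) ≫ J.map (P.mul X)) ⊗≫
        S.functor.map (S.mul (J.obj X)) ◁ (r.mulCell X).inv ⊗≫
        eqToHom (S.mul_assoc (J.obj X)) ▷ r.app X ⊗≫ 𝟙 _ := by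
  have key := r.mul_assoc X
  generalize (J.mapComp (P.functor.map (P.mul X)) (P.mul X)).inv ≫
    J.map₂ (eqToHom (P.mul_assoc X)) ≫
      (J.mapComp (P.mul (P.functor.obj X)) (P.mul X)).hom = K at key ⊢
  have hB : ((S.functor.mapComp (S.mul (J.obj X)) (r.app X)).inv ≫
          S.functor.map₂ (r.mulCell X).hom ≫
          (S.functor.mapComp (S.functor.map (r.app X))
            (r.app (P.functor.obj X) ≫ J.map (P.mul X))).hom) ≫
      ((S.functor.mapComp (S.functor.map (r.app X))
            (r.app (P.functor.obj X) ≫ J.map (P.mul X))).inv ≫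
          S.functor.map₂ (r.mulCell X).inv ≫
          (S.functor.mapComp (S.mul (J.obj X)) (r.app X)).hom) = 𝟙 _ := by
    simp only [Category.assoc, Iso.hom_inv_id_assoc]
    rw [← S.functor.map₂_comp_assoc, Iso.hom_inv_id]
    simp
  rw [← Category.assoc (S.functor.map₂ (r.mulCell X).hom),
    ← Category.assoc (S.functor.mapComp (S.mul (J.obj X)) (r.app X)).inv] at key
  have hI : IsIso ((S.functor.mapComp (S.mul (J.obj X)) (r.app X)).inv ≫
      S.functor.map₂ (r.mulCell X).hom ≫ (S.functor.mapComp (S.functor.map (r.app X))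
        (r.app (P.functor.obj X) ≫ J.map (P.mul X))).hom) := inferInstance
  generalize (S.functor.mapComp (S.mul (J.obj X)) (r.app X)).inv ≫
      S.functor.map₂ (r.mulCell X).hom ≫ (S.functor.mapComp (S.functor.map (r.app X))
        (r.app (P.functor.obj X) ≫ J.map (P.mul X))).hom = B at key hB hI
  generalize (S.functor.mapComp (S.functor.map (r.app X))
            (r.app (P.functor.obj X) ≫ J.map (P.mul X))).inv ≫
          S.functor.map₂ (r.mulCell X).inv ≫
          (S.functor.mapComp (S.mul (J.obj X)) (r.app X)).hom = B' at hB ⊢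
  -- Both sides are precomposed with the invertible cells given by `mulCell` and `B`, so that `key`
  -- applies; these are cancelled at the end.
  have h : S.functor.map (S.mul (J.obj X)) ◁ (r.mulCell X).hom ⊗≫
      B ▷ (r.app (P.functor.obj X) ≫ J.map (P.mul X)) ⊗≫ (S.functor.map (S.functor.map (r.app X)) ◁
        ((S.functor.mapComp (r.app (P.functor.obj X)) (J.map (P.mul X))).hom ▷
            (r.app (P.functor.obj X) ≫ J.map (P.mul X)) ≫ (α_ _ _ _).hom ≫
          S.functor.map (r.app (P.functor.obj X)) ◁ ((α_ _ _ _).inv ≫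
            (r.nat (P.mul X)).hom ▷ J.map (P.mul X) ≫ (α_ _ _ _).hom ≫
            r.app (P.functor.obj (P.functor.obj X)) ◁ K ≫ (α_ _ _ _).inv) ≫
          (α_ _ _ _).inv ≫ (r.mulCell (P.functor.obj X)).inv ▷ J.map (P.mul X) ≫ (α_ _ _ _).hom) ⊗≫
        eqToHom (S.mul_naturality (r.app X)) ▷ (r.app (P.functor.obj X) ≫ J.map (P.mul X)) ⊗≫
        S.mul (S.functor.obj (J.obj X)) ◁ (r.mulCell X).inv) =
      S.functor.map (S.mul (J.obj X)) ◁ (r.mulCell X).hom ⊗≫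
      B ▷ (r.app (P.functor.obj X) ≫ J.map (P.mul X)) ⊗≫
          (𝟙 (S.functor.map (S.functor.map (r.app X)) ≫
        S.functor.map (r.app (P.functor.obj X) ≫ J.map (P.mul X)) ≫
          r.app (P.functor.obj X) ≫ J.map (P.mul X)) ⊗≫
        B' ▷ (r.app (P.functor.obj X) ≫ J.map (P.mul X)) ⊗≫
        S.functor.map (S.mul (J.obj X)) ◁ (r.mulCell X).inv ⊗≫
        eqToHom (S.mul_assoc (J.obj X)) ▷ r.app X ⊗≫
          𝟙 (S.mul (S.functor.obj (J.obj X)) ≫ S.mul (J.obj X) ≫ r.app X)) := by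
    calc
      _ = (S.functor.map (S.mul (J.obj X)) ◁ (r.mulCell X).hom ⊗≫
            (B ≫ S.functor.map (S.functor.map (r.app X)) ◁
              (S.functor.mapComp (r.app (P.functor.obj X)) (J.map (P.mul X))).hom) ▷
                (r.app (P.functor.obj X) ≫ J.map (P.mul X)) ⊗≫
            S.functor.map (S.functor.map (r.app X)) ◁ S.functor.map (r.app (P.functor.obj X)) ◁
              (r.nat (P.mul X)).hom ▷ J.map (P.mul X) ⊗≫
            S.functor.map (S.functor.map (r.app X)) ◁ S.functor.map (r.app (P.functor.obj X)) ◁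
              r.app (P.functor.obj (P.functor.obj X)) ◁ K) ⊗≫
          S.functor.map (S.functor.map (r.app X)) ◁
            (r.mulCell (P.functor.obj X)).inv ▷ J.map (P.mul X) ⊗≫
          eqToHom (S.mul_naturality (r.app X)) ▷ (r.app (P.functor.obj X) ≫ J.map (P.mul X)) ⊗≫
          S.mul (S.functor.obj (J.obj X)) ◁ (r.mulCell X).inv := by bicategory
      _ = 𝟙 _ ⊗≫ eqToHom (S.mul_assoc (J.obj X)) ▷ r.app X ⊗≫
          S.mul (S.functor.obj (J.obj X)) ◁ (r.mulCell X).hom ⊗≫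
          eqToHom (S.mul_naturality (r.app X)).symm ▷
            (r.app (P.functor.obj X) ≫ J.map (P.mul X)) ⊗≫
          S.functor.map (S.functor.map (r.app X)) ◁
            ((r.mulCell (P.functor.obj X)).hom ≫ (r.mulCell (P.functor.obj X)).inv) ▷
              J.map (P.mul X) ⊗≫
          eqToHom (S.mul_naturality (r.app X)) ▷ (r.app (P.functor.obj X) ≫ J.map (P.mul X)) ⊗≫
          S.mul (S.functor.obj (J.obj X)) ◁ (r.mulCell X).inv := by rw [key]; bicategory
      _ = 𝟙 _ ⊗≫ eqToHom (S.mul_assoc (J.obj X)) ▷ r.app X ⊗≫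
          S.mul (S.functor.obj (J.obj X)) ◁ (r.mulCell X).hom ⊗≫
          (eqToHom (S.mul_naturality (r.app X)).symm ≫ eqToHom (S.mul_naturality (r.app X))) ▷
            (r.app (P.functor.obj X) ≫ J.map (P.mul X)) ⊗≫
          S.mul (S.functor.obj (J.obj X)) ◁ (r.mulCell X).inv := by
        rw [Iso.hom_inv_id]; bicategory
      _ = 𝟙 _ ⊗≫ eqToHom (S.mul_assoc (J.obj X)) ▷ r.app X ⊗≫
          S.mul (S.functor.obj (J.obj X)) ◁ ((r.mulCell X).hom ≫ (r.mulCell X).inv) := by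
        rw [eqToHom_trans, eqToHom_refl]; bicategory
      _ = S.functor.map (S.mul (J.obj X)) ◁ ((r.mulCell X).hom ≫ (r.mulCell X).inv) ⊗≫
          eqToHom (S.mul_assoc (J.obj X)) ▷ r.app X ⊗≫ 𝟙 _ := by
        rw [Iso.hom_inv_id]; bicategory
      _ = S.functor.map (S.mul (J.obj X)) ◁ (r.mulCell X).hom ⊗≫
          (B ≫ B') ▷ (r.app (P.functor.obj X) ≫ J.map (P.mul X)) ⊗≫
          S.functor.map (S.mul (J.obj X)) ◁ (r.mulCell X).inv ⊗≫
          eqToHom (S.mul_assoc (J.obj X)) ▷ r.app X ⊗≫ 𝟙 _ := by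
        rw [hB]; bicategory
      _ = _ := by bicategory
  revert h
  generalize (S.functor.map (S.functor.map (r.app X)) ◁
        ((S.functor.mapComp (r.app (P.functor.obj X)) (J.map (P.mul X))).hom ▷
            (r.app (P.functor.obj X) ≫ J.map (P.mul X)) ≫ (α_ _ _ _).hom ≫
          S.functor.map (r.app (P.functor.obj X)) ◁ ((α_ _ _ _).inv ≫
            (r.nat (P.mul X)).hom ▷ J.map (P.mul X) ≫ (α_ _ _ _).hom ≫
            r.app (P.functor.obj (P.functor.obj X)) ◁ K ≫ (α_ _ _ _).inv) ≫
          (α_ _ _ _).inv ≫ (r.mulCell (P.functor.obj X)).inv ▷ J.map (P.mul X) ≫ (α_ _ _ _).hom) ⊗≫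
        eqToHom (S.mul_naturality (r.app X)) ▷ (r.app (P.functor.obj X) ≫ J.map (P.mul X)) ⊗≫
        S.mul (S.functor.obj (J.obj X)) ◁ (r.mulCell X).inv) = x
  generalize (𝟙 (S.functor.map (S.functor.map (r.app X)) ≫
        S.functor.map (r.app (P.functor.obj X) ≫ J.map (P.mul X)) ≫
          r.app (P.functor.obj X) ≫ J.map (P.mul X)) ⊗≫
        B' ▷ (r.app (P.functor.obj X) ≫ J.map (P.mul X)) ⊗≫
        S.functor.map (S.mul (J.obj X)) ◁ (r.mulCell X).inv ⊗≫
        eqToHom (S.mul_assoc (J.obj X)) ▷ r.app X ⊗≫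
          𝟙 (S.mul (S.functor.obj (J.obj X)) ≫ S.mul (J.obj X) ≫ r.app X)) = y
  intro h
  simpa [bicategoricalComp, cancel_epi, cancel_mono] using h

/-- The law `r.unit_mul`, inverted in the same way, is the unit axiom of the pseudomorphism `r.app
X`. -/
theorem unitCell_unit_coherence (X : C) :
    𝟙 (r.app X) ⊗≫ r.app X ◁ ((J.mapId (P.functor.obj X)).inv ≫
        J.map₂ (eqToHom (P.unit_mul X).symm) ≫
        (J.mapComp (P.unit (P.functor.obj X)) (P.mul X)).hom ≫
          (r.unitCell (P.functor.obj X)).inv ▷ J.map (P.mul X) ≫ (α_ _ _ _).hom) ⊗≫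
        eqToHom (S.unit_naturality (r.app X)) ▷ (r.app (P.functor.obj X) ≫ J.map (P.mul X)) ⊗≫
        S.unit (S.functor.obj (J.obj X)) ◁ (r.mulCell X).inv =
      𝟙 (r.app X) ⊗≫ eqToHom (S.unit_mul (J.obj X)).symm ▷ r.app X ⊗≫ 𝟙 _ := by
  have key := r.unit_mul X
  have hK : ((J.mapComp (P.unit (P.functor.obj X)) (P.mul X)).inv ≫
      J.map₂ (eqToHom (P.unit_mul X)) ≫ (J.mapId (P.functor.obj X)).hom) ≫
      ((J.mapId (P.functor.obj X)).inv ≫ J.map₂ (eqToHom (P.unit_mul X).symm) ≫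
        (J.mapComp (P.unit (P.functor.obj X)) (P.mul X)).hom) = 𝟙 _ := by
    simp only [Category.assoc, Iso.hom_inv_id_assoc]
    rw [← J.map₂_comp_assoc]
    simp
  have e : 𝟙 (r.app X) ⊗≫ r.app X ◁ ((J.mapId (P.functor.obj X)).inv ≫
        J.map₂ (eqToHom (P.unit_mul X).symm) ≫
        (J.mapComp (P.unit (P.functor.obj X)) (P.mul X)).hom ≫
          (r.unitCell (P.functor.obj X)).inv ▷ J.map (P.mul X) ≫ (α_ _ _ _).hom) ⊗≫
        eqToHom (S.unit_naturality (r.app X)) ▷ (r.app (P.functor.obj X) ≫ J.map (P.mul X)) ⊗≫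
        S.unit (S.functor.obj (J.obj X)) ◁ (r.mulCell X).inv =
      𝟙 (r.app X) ⊗≫ r.app X ◁ ((J.mapId (P.functor.obj X)).inv ≫
        J.map₂ (eqToHom (P.unit_mul X).symm) ≫
        (J.mapComp (P.unit (P.functor.obj X)) (P.mul X)).hom) ⊗≫
        r.app X ◁ (r.unitCell (P.functor.obj X)).inv ▷ J.map (P.mul X) ⊗≫
        eqToHom (S.unit_naturality (r.app X)) ▷ (r.app (P.functor.obj X) ≫ J.map (P.mul X)) ⊗≫
        S.unit (S.functor.obj (J.obj X)) ◁ (r.mulCell X).inv := by bicategory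
  rw [e]
  generalize (J.mapComp (P.unit (P.functor.obj X)) (P.mul X)).inv ≫
      J.map₂ (eqToHom (P.unit_mul X)) ≫ (J.mapId (P.functor.obj X)).hom = K at key hK
  generalize (J.mapId (P.functor.obj X)).inv ≫ J.map₂ (eqToHom (P.unit_mul X).symm) ≫
        (J.mapComp (P.unit (P.functor.obj X)) (P.mul X)).hom = K' at hK ⊢
  calc
    _ = 𝟙 _ ⊗≫ (eqToHom (S.unit_mul (J.obj X)).symm ≫ eqToHom (S.unit_mul (J.obj X))) ▷ r.app X ⊗≫
        r.app X ◁ K' ⊗≫ r.app X ◁ (r.unitCell (P.functor.obj X)).inv ▷ J.map (P.mul X) ⊗≫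
        eqToHom (S.unit_naturality (r.app X)) ▷ (r.app (P.functor.obj X) ≫ J.map (P.mul X)) ⊗≫
        S.unit (S.functor.obj (J.obj X)) ◁ (r.mulCell X).inv := by
      rw [eqToHom_trans, eqToHom_refl]; bicategory
    _ = 𝟙 _ ⊗≫ eqToHom (S.unit_mul (J.obj X)).symm ▷ r.app X ⊗≫
        (𝟙 ((S.unit (S.functor.obj (J.obj X)) ≫ S.mul (J.obj X) ≫ r.app X)) ⊗≫
          eqToHom (S.unit_mul (J.obj X)) ▷ r.app X ⊗≫ 𝟙 (r.app X)) ⊗≫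
        r.app X ◁ K' ⊗≫ r.app X ◁ (r.unitCell (P.functor.obj X)).inv ▷ J.map (P.mul X) ⊗≫
        eqToHom (S.unit_naturality (r.app X)) ▷ (r.app (P.functor.obj X) ≫ J.map (P.mul X)) ⊗≫
        S.unit (S.functor.obj (J.obj X)) ◁ (r.mulCell X).inv := by bicategory
    _ = 𝟙 _ ⊗≫ eqToHom (S.unit_mul (J.obj X)).symm ▷ r.app X ⊗≫
        S.unit (S.functor.obj (J.obj X)) ◁ (r.mulCell X).hom ⊗≫
        eqToHom (S.unit_naturality (r.app X)).symm ▷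
          (r.app (P.functor.obj X) ≫ J.map (P.mul X)) ⊗≫
        r.app X ◁ (r.unitCell (P.functor.obj X)).hom ▷ J.map (P.mul X) ⊗≫
        r.app X ◁ (K ≫ K') ⊗≫ r.app X ◁ (r.unitCell (P.functor.obj X)).inv ▷ J.map (P.mul X) ⊗≫
        eqToHom (S.unit_naturality (r.app X)) ▷ (r.app (P.functor.obj X) ≫ J.map (P.mul X)) ⊗≫
        S.unit (S.functor.obj (J.obj X)) ◁ (r.mulCell X).inv := by rw [← key]; bicategory
    _ = 𝟙 _ ⊗≫ eqToHom (S.unit_mul (J.obj X)).symm ▷ r.app X ⊗≫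
        S.unit (S.functor.obj (J.obj X)) ◁ (r.mulCell X).hom ⊗≫
        eqToHom (S.unit_naturality (r.app X)).symm ▷
          (r.app (P.functor.obj X) ≫ J.map (P.mul X)) ⊗≫
        r.app X ◁ ((r.unitCell (P.functor.obj X)).hom ≫
          (r.unitCell (P.functor.obj X)).inv) ▷ J.map (P.mul X) ⊗≫
        eqToHom (S.unit_naturality (r.app X)) ▷ (r.app (P.functor.obj X) ≫ J.map (P.mul X)) ⊗≫
        S.unit (S.functor.obj (J.obj X)) ◁ (r.mulCell X).inv := by rw [hK]; bicategory
    _ = 𝟙 _ ⊗≫ eqToHom (S.unit_mul (J.obj X)).symm ▷ r.app X ⊗≫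
        S.unit (S.functor.obj (J.obj X)) ◁ (r.mulCell X).hom ⊗≫
        (eqToHom (S.unit_naturality (r.app X)).symm ≫ eqToHom (S.unit_naturality (r.app X))) ▷
          (r.app (P.functor.obj X) ≫ J.map (P.mul X)) ⊗≫
        S.unit (S.functor.obj (J.obj X)) ◁ (r.mulCell X).inv := by
      rw [Iso.hom_inv_id]; bicategory
    _ = 𝟙 _ ⊗≫ eqToHom (S.unit_mul (J.obj X)).symm ▷ r.app X ⊗≫
        S.unit (S.functor.obj (J.obj X)) ◁ ((r.mulCell X).hom ≫ (r.mulCell X).inv) := by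
      rw [eqToHom_trans, eqToHom_refl]; bicategory
    _ = _ := by rw [Iso.hom_inv_id]; bicategory

end TwoMonad.Restriction
end RestrictedFree

/-! ### The universal property of `J P X`. -/

section RestrictedFree

variable {C : Type u₁} [Bicategory.{w₁, v₁} C] [Strict C]
  {D : Type u₂} [Bicategory.{w₂, v₂} D] [Strict D]
  {J : C ⥤ᵖ D} {P : TwoMonad C} {S : TwoMonad D}

namespace TwoMonad.Restriction

variable (r : TwoMonad.Restriction J P S)

/-- The comparison `S J X ⟶ J P X` is a pseudomorphism from the free algebra. -/
def appMor (X : C) : PseudoMor (S.freeData (J.obj X)) (r.alg (P.free X)) (r.app X) where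
  cell := (r.mulCell X).symm
  assoc_coherence := r.mulCell_assoc_coherence X
  unit_coherence := r.unitCell_unit_coherence X

variable {X : C} {Y : D} (b : PseudoAlgebra S Y)

/-- The extension of `f : J X ⟶ Y` to `J P X`. -/
def extend (f : J.obj X ⟶ Y) : J.obj (P.functor.obj X) ⟶ Y :=
  r.inv X ≫ S.functor.map f ≫ b.act

/-- The restriction of the extension of `f` along the comparison `S J X ⟶ J P X`. -/
def appExtend (f : J.obj X ⟶ Y) : S.functor.map f ≫ b.act ≅ r.app X ≫ r.extend b f :=
  (λ_ _).symm ≪≫ whiskerRightIso (r.app_inv X).symm _ ≪≫ α_ _ _ _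

/-- The structure of `b.freeExt f` is transported along `appExtend` to `r.app X ≫ r.extend b f`, and
then descends along the equivalence `r.app X`. -/
theorem exists_extendMor (f : J.obj X ⟶ Y) :
    ∃ ψ : PseudoMor (r.alg (P.free X)) b.toPseudoAlgebraData (r.extend b f),
      IsAlgebraCell (b.freeExt f) ((r.appMor X).comp ψ) (r.appExtend b f).hom := by
  obtain ⟨ψ, hψ⟩ := PseudoMor.exists_comp_cell_eq (r.appMor X) (r.app_inv X) (r.inv_app X)
    ((b.freeExt f).ofIso (r.appExtend b f))
  refine ⟨ψ, ?_⟩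
  have h := (b.freeExt f).isAlgebraCell_ofIso (r.appExtend b f)
  rw [IsAlgebraCell, hψ] at h
  exact h

/-- The pseudomorphism structure on the extension of `f`. -/
noncomputable def extendMor (f : J.obj X ⟶ Y) :
    PseudoMor (r.alg (P.free X)) b.toPseudoAlgebraData (r.extend b f) :=
  (r.exists_extendMor b f).choose

theorem isAlgebraCell_appExtend (f : J.obj X ⟶ Y) :
    IsAlgebraCell (b.freeExt f) ((r.appMor X).comp (r.extendMor b f)) (r.appExtend b f).hom :=
  (r.exists_extendMor b f).choose_spec

/-- The extension of 2-cells. -/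
def extendMap {f g : J.obj X ⟶ Y} (α : f ⟶ g) : r.extend b f ⟶ r.extend b g :=
  r.inv X ◁ S.functor.map₂ α ▷ b.act

theorem appExtend_naturality {f g : J.obj X ⟶ Y} (α : f ⟶ g) :
    S.functor.map₂ α ▷ b.act ≫ (r.appExtend b g).hom =
      (r.appExtend b f).hom ≫ r.app X ◁ r.extendMap b α := by
  have key : S.functor.map₂ α ▷ b.act ≫ (λ_ _).inv ≫
        (r.app_inv X).inv ▷ (S.functor.map g ≫ b.act) ≫ (α_ _ _ _).hom =
      ((λ_ _).inv ≫ (r.app_inv X).inv ▷ (S.functor.map f ≫ b.act) ≫ (α_ _ _ _).hom) ≫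
        r.app X ◁ r.inv X ◁ S.functor.map₂ α ▷ b.act := by
    calc
      _ = 𝟙 _ ⊗≫ (𝟙 _ ◁ S.functor.map₂ α ▷ b.act ≫
          (r.app_inv X).inv ▷ (S.functor.map g ≫ b.act)) ⊗≫
            𝟙 (r.app X ≫ r.inv X ≫ S.functor.map g ≫ b.act) := by bicategory
      _ = _ := by rw [whisker_exchange]; bicategory
  exact key

/-- After whiskering with `r.app X`, the extended 2-cell is the algebra 2-cell between free
extensions, conjugated by `appExtend`. -/
theorem isAlgebraCell_extendMap {f g : J.obj X ⟶ Y} (α : f ⟶ g) :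
    IsAlgebraCell (r.extendMor b f) (r.extendMor b g) (r.extendMap b α) := by
  refine isAlgebraCell_of_whiskerLeft (κ := r.appMor X) (r.app_inv X) (r.inv_app X) ?_
  have h : r.app X ◁ r.extendMap b α =
      (r.appExtend b f).inv ≫ S.functor.map₂ α ▷ b.act ≫ (r.appExtend b g).hom := by
    rw [appExtend_naturality, Iso.inv_hom_id_assoc]
  rw [h]
  exact (r.isAlgebraCell_appExtend b f).symm.comp
    ((b.isAlgebraCell_freeExt α).comp (r.isAlgebraCell_appExtend b g))

/-- The restriction of the extension of `f` along the unit `J X ⟶ J P X` is `f`. -/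
def unitExtend (f : J.obj X ⟶ Y) : (S.unit (J.obj X) ≫ r.app X) ≫ r.extend b f ≅ f :=
  α_ _ _ _ ≪≫ whiskerLeftIso (S.unit (J.obj X)) (r.appExtend b f).symm ≪≫ b.freeUnit f

theorem unitExtend_naturality {f g : J.obj X ⟶ Y} (α : f ⟶ g) :
    (S.unit (J.obj X) ≫ r.app X) ◁ r.extendMap b α ≫ (r.unitExtend b g).hom =
      (r.unitExtend b f).hom ≫ α := by
  have h : r.app X ◁ r.extendMap b α ≫ (r.appExtend b g).inv =
      (r.appExtend b f).inv ≫ S.functor.map₂ α ▷ b.act := by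
    rw [Iso.eq_inv_comp, ← Category.assoc, ← appExtend_naturality, Category.assoc,
      Iso.hom_inv_id, Category.comp_id]
  simp only [unitExtend, Iso.trans_hom, whiskerLeftIso_hom, Iso.symm_hom, Category.assoc]
  rw [← b.freeUnit_naturality α, ← Bicategory.whiskerLeft_comp_assoc, ← h]
  simp

theorem unit_whiskerLeft_extendMap {f g : J.obj X ⟶ Y} (α : f ⟶ g) :
    (S.unit (J.obj X) ≫ r.app X) ◁ r.extendMap b α =
      (r.unitExtend b f).hom ≫ α ≫ (r.unitExtend b g).inv := by
  rw [← Category.assoc, Iso.eq_comp_inv, unitExtend_naturality]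

variable {r b}

/-- Algebra 2-cells between pseudomorphisms out of `J P X` are determined by their restriction along
the unit. -/
theorem hom_ext {h k : J.obj (P.functor.obj X) ⟶ Y}
    {φ : PseudoMor (r.alg (P.free X)) b.toPseudoAlgebraData h}
    {ψ : PseudoMor (r.alg (P.free X)) b.toPseudoAlgebraData k} {α β : h ⟶ k}
    (hα : IsAlgebraCell φ ψ α) (hβ : IsAlgebraCell φ ψ β)
    (e : (S.unit (J.obj X) ≫ r.app X) ◁ α = (S.unit (J.obj X) ≫ r.app X) ◁ β) : α = β := by
  refine whiskerLeft_injective (r.app_inv X) (r.inv_app X) ?_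
  refine PseudoAlgebra.free_ext (hα.whiskerLeft (r.appMor X)) (hβ.whiskerLeft (r.appMor X)) ?_
  simpa [cancel_epi, cancel_mono] using e

/-- Every invertible 2-cell between the restrictions of two pseudomorphisms out of `J P X` along the
unit is the restriction of an algebra 2-cell. -/
theorem exists_lift {h k : J.obj (P.functor.obj X) ⟶ Y}
    (φ : PseudoMor (r.alg (P.free X)) b.toPseudoAlgebraData h)
    (ψ : PseudoMor (r.alg (P.free X)) b.toPseudoAlgebraData k)
    (γ : (S.unit (J.obj X) ≫ r.app X) ≫ h ≅ (S.unit (J.obj X) ≫ r.app X) ≫ k) :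
    ∃ δ : h ≅ k, IsAlgebraCell φ ψ δ.hom ∧ (S.unit (J.obj X) ≫ r.app X) ◁ δ.hom = γ.hom := by
  -- The lift is found first over `S J X`, and then descends along `r.app X` by fullness.
  obtain ⟨ζ, hζ, e⟩ := PseudoAlgebra.exists_free_lift ((r.appMor X).comp φ)
    ((r.appMor X).comp ψ) ((α_ _ _ _).symm ≪≫ γ ≪≫ α_ _ _ _)
  obtain ⟨δ, hδ⟩ := exists_whiskerLeft_eq (r.app_inv X) (r.inv_app X) ζ
  refine ⟨δ, isAlgebraCell_of_whiskerLeft (κ := r.appMor X) (r.app_inv X) (r.inv_app X)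
    (by rw [hδ]; exact hζ), ?_⟩
  rw [← hδ] at e
  simp [e]

end TwoMonad.Restriction

end RestrictedFree

/-! ### Pseudomonads on the Kleisli bicategory -/

section KleisliPseudomonad

variable {C : Type u₁} [Bicategory.{w₁, v₁} C] {D : Type u₂} [Bicategory.{w₂, v₂} D]

/-- A pseudomonad in extension form on the Kleisli bicategory of `T`, expressed in terms of the
bicategory `D` in which `T` takes its values. -/
structure KleisliPseudomonad {J : C ⥤ᵖ D} (T : RelPseudomonad J) where
  obj : C → C
  unit (X : C) : J.obj X ⟶ T.obj (obj X)
  ext {X Y : C} : (J.obj X ⟶ T.obj (obj Y)) ⥤ (J.obj (obj X) ⟶ T.obj (obj Y))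
  mu {X Y Z : C} (g : J.obj Y ⟶ T.obj (obj Z)) (f : J.obj X ⟶ T.obj (obj Y)) :
    ext.obj (f ≫ T.ext.obj (ext.obj g)) ≅ ext.obj f ≫ T.ext.obj (ext.obj g)
  eta {X Y : C} (f : J.obj X ⟶ T.obj (obj Y)) : f ≅ unit X ≫ T.ext.obj (ext.obj f)
  theta (X : C) : ext.obj (unit X) ≅ T.unit (obj X)
  mu_naturality_right {X Y Z : C} (g : J.obj Y ⟶ T.obj (obj Z)) {f f' : J.obj X ⟶ T.obj (obj Y)}
      (α : f ⟶ f') :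
    ext.map (α ▷ T.ext.obj (ext.obj g)) ≫ (mu g f').hom =
      (mu g f).hom ≫ ext.map α ▷ T.ext.obj (ext.obj g)
  mu_naturality_left {X Y Z : C} {g g' : J.obj Y ⟶ T.obj (obj Z)} (β : g ⟶ g')
      (f : J.obj X ⟶ T.obj (obj Y)) :
    ext.map (f ◁ T.ext.map (ext.map β)) ≫ (mu g' f).hom =
      (mu g f).hom ≫ ext.obj f ◁ T.ext.map (ext.map β)
  eta_naturality {X Y : C} {f f' : J.obj X ⟶ T.obj (obj Y)} (α : f ⟶ f') :
    α ≫ (eta f').hom = (eta f).hom ≫ unit X ◁ T.ext.map (ext.map α)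
  -- The Kleisli associator is expanded into the associator of `D` and `T.mu`. Likewise `T.eta` in
  -- the next law is the inverse of the Kleisli left unitor.
  associativity {X Y Z V : C} (h : J.obj Z ⟶ T.obj (obj V)) (g : J.obj Y ⟶ T.obj (obj Z))
      (f : J.obj X ⟶ T.obj (obj Y)) :
    ext.map (f ◁ T.ext.map (mu h g).hom) ≫
        ext.map (f ◁ (T.mu (ext.obj h) (ext.obj g)).hom ≫ (α_ _ _ _).inv) ≫
        (mu h (f ≫ T.ext.obj (ext.obj g))).hom ≫ (mu g f).hom ▷ T.ext.obj (ext.obj h) =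
      (mu (g ≫ T.ext.obj (ext.obj h)) f).hom ≫ ext.obj f ◁ T.ext.map (mu h g).hom ≫
        ext.obj f ◁ (T.mu (ext.obj h) (ext.obj g)).hom ≫ (α_ _ _ _).inv
  unitality {X Y : C} (f : J.obj X ⟶ T.obj (obj Y)) :
    ext.map (eta f).hom ≫ (mu f (unit X)).hom ≫ (theta X).hom ▷ T.ext.obj (ext.obj f) =
      (T.eta (ext.obj f)).hom

namespace KleisliPseudomonad

variable {J : C ⥤ᵖ D} {T : RelPseudomonad J} (K : KleisliPseudomonad T)

/-- The pseudomonad on the Kleisli bicategory. -/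
def toRelPseudomonad : RelPseudomonad (Pseudofunctor.id (KleisliBicat T)) where
  obj X := ⟨K.obj X.of⟩
  unit X := K.unit X.of
  -- The Kleisli hom-categories are those of `D` only after unfolding, so functors and isomorphisms
  -- are repackaged field by field.
  ext {X Y} :=
    { obj := (K.ext (X := X.of) (Y := Y.of)).obj
      map := (K.ext (X := X.of) (Y := Y.of)).map
      map_id := (K.ext (X := X.of) (Y := Y.of)).map_id
      map_comp := (K.ext (X := X.of) (Y := Y.of)).map_comp }
  mu g f :=
    { hom := (K.mu g f).hom
      inv := (K.mu g f).inv
      hom_inv_id := (K.mu g f).hom_inv_id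
      inv_hom_id := (K.mu g f).inv_hom_id }
  eta f :=
    { hom := (K.eta f).hom
      inv := (K.eta f).inv
      hom_inv_id := (K.eta f).hom_inv_id
      inv_hom_id := (K.eta f).inv_hom_id }
  theta X :=
    { hom := (K.theta X.of).hom
      inv := (K.theta X.of).inv
      hom_inv_id := (K.theta X.of).hom_inv_id
      inv_hom_id := (K.theta X.of).inv_hom_id }
  mu_naturality_right g _ _ α := K.mu_naturality_right g α
  mu_naturality_left β f := K.mu_naturality_left β f
  eta_naturality α := K.eta_naturality α
  associativity h g f := K.associativity h g f
  unitality f := K.unitality f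

/-! ### The axioms of the composite relative pseudomonad. -/

section

variable {X Y Z V : C} (h : J.obj Z ⟶ T.obj (K.obj V)) (g : J.obj Y ⟶ T.obj (K.obj Z))
  (f : J.obj X ⟶ T.obj (K.obj Y))

theorem composite_mu_naturality_right {f f' : J.obj X ⟶ T.obj (K.obj Y)} (α : f ⟶ f') :
    T.ext.map (K.ext.map (α ▷ T.ext.obj (K.ext.obj g))) ≫
        T.ext.map (K.mu g f').hom ≫ (T.mu (K.ext.obj g) (K.ext.obj f')).hom =
      (T.ext.map (K.mu g f).hom ≫ (T.mu (K.ext.obj g) (K.ext.obj f)).hom) ≫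
        T.ext.map (K.ext.map α) ▷ T.ext.obj (K.ext.obj g) := by
  rw [← Functor.map_comp_assoc, K.mu_naturality_right, Functor.map_comp_assoc,
    T.mu_naturality_right, Category.assoc]

theorem composite_mu_naturality_left {g g' : J.obj Y ⟶ T.obj (K.obj Z)} (β : g ⟶ g') :
    T.ext.map (K.ext.map (f ◁ T.ext.map (K.ext.map β))) ≫
        T.ext.map (K.mu g' f).hom ≫ (T.mu (K.ext.obj g') (K.ext.obj f)).hom =
      (T.ext.map (K.mu g f).hom ≫ (T.mu (K.ext.obj g) (K.ext.obj f)).hom) ≫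
        T.ext.obj (K.ext.obj f) ◁ T.ext.map (K.ext.map β) := by
  rw [← Functor.map_comp_assoc, K.mu_naturality_left, Functor.map_comp_assoc,
    T.mu_naturality_left, Category.assoc]

/-- Naturality of `T.mu` in both variables separates the cells of `K` from those of `T`; then
`T.ext` of the associativity law of `K` and the associativity law of `T` apply in turn. -/
theorem composite_associativity :
    T.ext.map (K.ext.map (f ◁ (T.ext.map (K.mu h g).hom ≫ (T.mu _ _).hom))) ≫
        T.ext.map (K.ext.map (α_ f (T.ext.obj (K.ext.obj g)) (T.ext.obj (K.ext.obj h))).inv) ≫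
        (T.ext.map (K.mu h (f ≫ T.ext.obj (K.ext.obj g))).hom ≫ (T.mu _ _).hom) ≫
        (T.ext.map (K.mu g f).hom ≫ (T.mu _ _).hom) ▷ T.ext.obj (K.ext.obj h) =
      (T.ext.map (K.mu (g ≫ T.ext.obj (K.ext.obj h)) f).hom ≫ (T.mu _ _).hom) ≫
        T.ext.obj (K.ext.obj f) ◁ (T.ext.map (K.mu h g).hom ≫ (T.mu _ _).hom) ≫
        (α_ _ _ _).inv := by
  have hK := congrArg T.ext.map (K.associativity h g f)
  have hT := T.associativity (K.ext.obj h) (K.ext.obj g) (K.ext.obj f)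
  have h₁ := T.mu_naturality_right (K.ext.obj h) (K.mu g f).hom
  have h₂ := T.mu_naturality_left (K.mu h g).hom (K.ext.obj f)
  simp only [Functor.map_comp, Category.assoc, Bicategory.whiskerLeft_comp,
    comp_whiskerRight] at hK hT ⊢
  rw [← reassoc_of% h₁, reassoc_of% hK, hT, reassoc_of% h₂]

/-- The unit law of `K` ends in `T.eta`, which is where the unit law of `T` begins. -/
theorem composite_unitality :
    T.ext.map (K.ext.map (K.eta f).hom) ≫
        (T.ext.map (K.mu f (K.unit X)).hom ≫ (T.mu _ _).hom) ≫
        (T.ext.map (K.theta X).hom ≫ (T.theta _).hom) ▷ T.ext.obj (K.ext.obj f) =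
      (λ_ (T.ext.obj (K.ext.obj f))).inv := by
  have hK := congrArg T.ext.map (K.unitality f)
  have h₁ := T.mu_naturality_right (K.ext.obj f) (K.theta X).hom
  simp only [Functor.map_comp, Category.assoc, comp_whiskerRight] at hK ⊢
  rw [← reassoc_of% h₁, reassoc_of% hK, T.unitality]

end

/-- The composite of the Kleisli relative pseudoadjunctions, as a relative pseudomonad. -/
def composite : RelPseudomonad J where
  toRelPseudomonadData := T.compositeData K.toRelPseudomonad
  mu_naturality_right g _ _ α := K.composite_mu_naturality_right g α
  mu_naturality_left β f := K.composite_mu_naturality_left f β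
  eta_naturality α := K.eta_naturality α
  associativity h g f := K.composite_associativity h g f
  unitality f := K.composite_unitality f

end KleisliPseudomonad

end KleisliPseudomonad

/-! ### The extension of `S` to the Kleisli bicategory -/

section Extension

variable {C : Type u₁} [Bicategory.{w₁, v₁} C] [Strict C]
  {D : Type u₂} [Bicategory.{w₂, v₂} D] [Strict D]
  {J : C ⥤ᵖ D} {P : TwoMonad C} {S : TwoMonad D}
  {r : TwoMonad.Restriction J P S} {T : RelPseudomonad J} (L : PseudoLifting T r)

namespace PseudoLifting

/-- The extension functors of the extension of `S` to the Kleisli bicategory. -/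
@[simps]
def extFunctor (X Y : C) : (J.obj X ⟶ T.obj (P.functor.obj Y)) ⥤
    (J.obj (P.functor.obj X) ⟶ T.obj (P.functor.obj Y)) where
  obj f := r.extend (L.alg (P.free Y)) f
  map α := r.extendMap (L.alg (P.free Y)) α
  map_id f := by simp [TwoMonad.Restriction.extendMap, TwoMonad.Restriction.extend]
  map_comp α β := by
    simp only [TwoMonad.Restriction.extendMap, PrelaxFunctor.map₂_comp, comp_whiskerRight,
      Bicategory.whiskerLeft_comp]
    rfl

variable (r T) in
/-- The unit of the extension of `S` to the Kleisli bicategory. -/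
abbrev kleisliUnit (X : C) : J.obj X ⟶ T.obj (P.functor.obj X) :=
  (S.unit (J.obj X) ≫ r.app X) ≫ T.unit (P.functor.obj X)

/-! ### The structural 2-cells of the extension and their axioms. -/

section

variable {X Y Z V : C} (h : J.obj Z ⟶ T.obj (P.functor.obj V))
  (g : J.obj Y ⟶ T.obj (P.functor.obj Z)) (f : J.obj X ⟶ T.obj (P.functor.obj Y))

/-- The extension of `f : J X ⟶ T P Y` to a pseudomorphism `T P X ⟶ T P Y`. -/
abbrev extExt : T.obj (P.functor.obj X) ⟶ T.obj (P.functor.obj Y) :=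
  T.ext.obj ((L.extFunctor X Y).obj f)

/-- The pseudomorphism structure on the extension of `f`. -/
noncomputable abbrev extMor : PseudoMor (r.alg (P.free X)) (L.alg (P.free Y)).toPseudoAlgebraData
    ((L.extFunctor X Y).obj f) :=
  r.extendMor (L.alg (P.free Y)) f

theorem isAlgebraCell_extFunctor_map {f f' : J.obj X ⟶ T.obj (P.functor.obj Y)} (α : f ⟶ f') :
    IsAlgebraCell (L.extMor f) (L.extMor f') ((L.extFunctor X Y).map α) :=
  r.isAlgebraCell_extendMap _ α

/-- The restriction of the extension of `f` along the unit is `f`. -/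
def unitExt : (S.unit (J.obj X) ≫ r.app X) ≫ (L.extFunctor X Y).obj f ≅ f :=
  r.unitExtend (L.alg (P.free Y)) f

theorem unit_whiskerLeft_extFunctor_map {f f' : J.obj X ⟶ T.obj (P.functor.obj Y)} (α : f ⟶ f') :
    (S.unit (J.obj X) ≫ r.app X) ◁ (L.extFunctor X Y).map α =
      (L.unitExt f).hom ≫ α ≫ (L.unitExt f').inv :=
  r.unit_whiskerLeft_extendMap _ α

/-- Both 1-cells carry pseudomorphism structures and restrict along the unit to `f ≫ L.extExt g`, up
to `unitExt`; the comparison of restrictions is lifted. The algebra 2-cell property and the formula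
on restrictions determine the lift. -/
theorem exists_mu :
    ∃ δ : (L.extFunctor X Z).obj (f ≫ L.extExt g) ≅ (L.extFunctor X Y).obj f ≫ L.extExt g,
      IsAlgebraCell (L.extMor (f ≫ L.extExt g)) ((L.extMor f).comp (L.ext (L.extMor g))) δ.hom ∧
      (S.unit (J.obj X) ≫ r.app X) ◁ δ.hom = (L.unitExt (f ≫ L.extExt g)).hom ≫
        (L.unitExt f).inv ▷ L.extExt g ≫ (α_ _ _ _).hom :=
  TwoMonad.Restriction.exists_lift (L.extMor (f ≫ L.extExt g))
    ((L.extMor f).comp (L.ext (L.extMor g)))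
    (L.unitExt (f ≫ L.extExt g) ≪≫ whiskerRightIso (L.unitExt f).symm (L.extExt g) ≪≫ α_ _ _ _)

/-- The 2-cells `mu` of the extension of `S` to the Kleisli bicategory. -/
noncomputable def kleisliMu :
    (L.extFunctor X Z).obj (f ≫ L.extExt g) ≅ (L.extFunctor X Y).obj f ≫ L.extExt g :=
  (L.exists_mu g f).choose

theorem isAlgebraCell_kleisliMu :
    IsAlgebraCell (L.extMor (f ≫ L.extExt g)) ((L.extMor f).comp (L.ext (L.extMor g)))
      (L.kleisliMu g f).hom :=
  (L.exists_mu g f).choose_spec.1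

theorem unit_whiskerLeft_kleisliMu :
    (S.unit (J.obj X) ≫ r.app X) ◁ (L.kleisliMu g f).hom = (L.unitExt (f ≫ L.extExt g)).hom ≫
        (L.unitExt f).inv ▷ L.extExt g ≫ (α_ _ _ _).hom :=
  (L.exists_mu g f).choose_spec.2

variable (X) in
-- The restriction of `T.unit` along the unit is `kleisliUnit` by definition, so `unitExt` is the
-- isomorphism to lift.
theorem exists_theta :
    ∃ δ : (L.extFunctor X X).obj (kleisliUnit r T X) ≅ T.unit (P.functor.obj X),
      IsAlgebraCell (L.extMor (kleisliUnit r T X)) (L.unit (P.free X)) δ.hom ∧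
      (S.unit (J.obj X) ≫ r.app X) ◁ δ.hom = (L.unitExt (kleisliUnit r T X)).hom :=
  TwoMonad.Restriction.exists_lift (L.extMor (kleisliUnit r T X)) (L.unit (P.free X))
    (L.unitExt (kleisliUnit r T X))

variable (X) in
/-- The 2-cells `theta` of the extension of `S` to the Kleisli bicategory. -/
noncomputable def kleisliTheta :
    (L.extFunctor X X).obj (kleisliUnit r T X) ≅ T.unit (P.functor.obj X) :=
  (L.exists_theta X).choose

variable (X) in
theorem isAlgebraCell_kleisliTheta :
    IsAlgebraCell (L.extMor (kleisliUnit r T X)) (L.unit (P.free X)) (L.kleisliTheta X).hom :=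
  (L.exists_theta X).choose_spec.1

variable (X) in
theorem unit_whiskerLeft_kleisliTheta :
    (S.unit (J.obj X) ≫ r.app X) ◁ (L.kleisliTheta X).hom =
      (L.unitExt (kleisliUnit r T X)).hom :=
  (L.exists_theta X).choose_spec.2

/-- The 2-cells `eta` of the extension of `S` to the Kleisli bicategory. -/
def kleisliEta : f ≅ kleisliUnit r T X ≫ L.extExt f :=
  (L.unitExt f).symm ≪≫ whiskerLeftIso (S.unit (J.obj X) ≫ r.app X)
    (T.eta ((L.extFunctor X Y).obj f)) ≪≫ (α_ _ _ _).symm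

/-- Both sides are algebra 2-cells, so `hom_ext` reduces the equation to restrictions along the
unit, where conjugation by `unitExt` cancels. -/
theorem kleisliMu_naturality_right {f f' : J.obj X ⟶ T.obj (P.functor.obj Y)} (α : f ⟶ f') :
    (L.extFunctor X Z).map (α ▷ L.extExt g) ≫ (L.kleisliMu g f').hom =
      (L.kleisliMu g f).hom ≫ (L.extFunctor X Y).map α ▷ L.extExt g := by
  refine TwoMonad.Restriction.hom_ext
    ((L.isAlgebraCell_extFunctor_map _).comp (L.isAlgebraCell_kleisliMu g f'))
    ((L.isAlgebraCell_kleisliMu g f).comp ((L.isAlgebraCell_extFunctor_map α).whiskerRight _)) ?_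
  have e : (S.unit (J.obj X) ≫ r.app X) ◁ (L.extFunctor X Y).map α ▷ L.extExt g =
      (α_ _ _ _).inv ≫ ((S.unit (J.obj X) ≫ r.app X) ◁ (L.extFunctor X Y).map α) ▷ L.extExt g ≫
        (α_ _ _ _).hom := by
    rw [whisker_assoc]; simp
  rw [Bicategory.whiskerLeft_comp, Bicategory.whiskerLeft_comp, e,
    unit_whiskerLeft_kleisliMu, unit_whiskerLeft_kleisliMu, unit_whiskerLeft_extFunctor_map,
    unit_whiskerLeft_extFunctor_map]
  simp only [Category.assoc, Iso.inv_hom_id_assoc, Iso.hom_inv_id_assoc, comp_whiskerRight]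
  rw [inv_hom_whiskerRight_assoc]

theorem kleisliMu_naturality_left {g g' : J.obj Y ⟶ T.obj (P.functor.obj Z)} (β : g ⟶ g') :
    (L.extFunctor X Z).map (f ◁ T.ext.map ((L.extFunctor Y Z).map β)) ≫ (L.kleisliMu g' f).hom =
      (L.kleisliMu g f).hom ≫ (L.extFunctor X Y).obj f ◁ T.ext.map ((L.extFunctor Y Z).map β) := by
  refine TwoMonad.Restriction.hom_ext
    ((L.isAlgebraCell_extFunctor_map _).comp (L.isAlgebraCell_kleisliMu g' f))
    ((L.isAlgebraCell_kleisliMu g f).comp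
      -- The lifting enters here: `T.ext` preserves algebra 2-cells.
      ((L.ext_map _ _ _ (L.isAlgebraCell_extFunctor_map β)).whiskerLeft _)) ?_
  rw [Bicategory.whiskerLeft_comp, Bicategory.whiskerLeft_comp,
    unit_whiskerLeft_kleisliMu, unit_whiskerLeft_kleisliMu, unit_whiskerLeft_extFunctor_map]
  simp only [Category.assoc, Iso.inv_hom_id_assoc]
  rw [whisker_exchange_assoc]
  simp

theorem kleisliEta_naturality {f f' : J.obj X ⟶ T.obj (P.functor.obj Y)} (α : f ⟶ f') :
    α ≫ (L.kleisliEta f').hom = (L.kleisliEta f).hom ≫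
      kleisliUnit r T X ◁ T.ext.map ((L.extFunctor X Y).map α) := by
  have e := congrArg ((S.unit (J.obj X) ≫ r.app X) ◁ ·)
    (T.eta_naturality ((L.extFunctor X Y).map α))
  simp only [Bicategory.whiskerLeft_comp, unit_whiskerLeft_extFunctor_map] at e
  rw [← cancel_epi (L.unitExt f).hom]
  simp only [kleisliEta, Iso.trans_hom, Iso.symm_hom, whiskerLeftIso_hom, Category.assoc,
    Iso.hom_inv_id_assoc, kleisliUnit, comp_whiskerLeft] at e ⊢
  simp [reassoc_of% e]

/-- Because the lifting makes `T.mu` an algebra 2-cell, both sides are algebra 2-cells. On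
restrictions the `T.mu` and `kleisliMu` cells occur on both sides, and interchange with `unitExt`
identifies them. -/
theorem kleisli_associativity :
    (L.extFunctor X V).map (f ◁ T.ext.map (L.kleisliMu h g).hom) ≫
        (L.extFunctor X V).map (f ◁ (T.mu ((L.extFunctor Z V).obj h)
          ((L.extFunctor Y Z).obj g)).hom ≫ (α_ _ _ _).inv) ≫
        (L.kleisliMu h (f ≫ L.extExt g)).hom ≫ (L.kleisliMu g f).hom ▷ L.extExt h =
      (L.kleisliMu (g ≫ L.extExt h) f).hom ≫
        (L.extFunctor X Y).obj f ◁ T.ext.map (L.kleisliMu h g).hom ≫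
        (L.extFunctor X Y).obj f ◁ (T.mu ((L.extFunctor Z V).obj h)
          ((L.extFunctor Y Z).obj g)).hom ≫ (α_ _ _ _).inv := by
  refine TwoMonad.Restriction.hom_ext
    ((L.isAlgebraCell_extFunctor_map _).comp <| (L.isAlgebraCell_extFunctor_map _).comp <|
      (L.isAlgebraCell_kleisliMu h _).comp ((L.isAlgebraCell_kleisliMu g f).whiskerRight _))
    ((L.isAlgebraCell_kleisliMu _ f).comp <|
      ((L.ext_map _ _ _ (L.isAlgebraCell_kleisliMu h g)).whiskerLeft _).comp <|
      ((L.mu (L.extMor g) (L.extMor h)).whiskerLeft _).comp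
        (IsAlgebraCell.associator _ _ _).symm) ?_
  have e : (S.unit (J.obj X) ≫ r.app X) ◁ (L.kleisliMu g f).hom ▷ L.extExt h =
      (α_ _ _ _).inv ≫ ((S.unit (J.obj X) ≫ r.app X) ◁ (L.kleisliMu g f).hom) ▷ L.extExt h ≫
        (α_ _ _ _).hom := by
    rw [whisker_assoc]; simp
  rw [← Functor.map_comp_assoc]
  simp only [Bicategory.whiskerLeft_comp, e, unit_whiskerLeft_kleisliMu,
    unit_whiskerLeft_extFunctor_map, Category.assoc, Iso.inv_hom_id_assoc, comp_whiskerRight]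
  rw [Iso.hom_inv_id_assoc, inv_hom_whiskerRight_assoc, ← associator_inv_naturality_left_assoc,
    whisker_exchange_assoc, whisker_exchange_assoc]
  simp

/-- The right side is an algebra 2-cell because the lifting makes `T.eta` one. On the left,
restriction exposes the `T.eta` inside `kleisliEta`, and the `unitExt` factors cancel. -/
theorem kleisli_unitality :
    (L.extFunctor X Y).map (L.kleisliEta f).hom ≫ (L.kleisliMu f (kleisliUnit r T X)).hom ≫
        (L.kleisliTheta X).hom ▷ L.extExt f = (T.eta ((L.extFunctor X Y).obj f)).hom := by
  refine TwoMonad.Restriction.hom_ext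
    ((L.isAlgebraCell_extFunctor_map _).comp <| (L.isAlgebraCell_kleisliMu f _).comp
      ((L.isAlgebraCell_kleisliTheta X).whiskerRight _)) (L.eta (L.extMor f)) ?_
  have e : (S.unit (J.obj X) ≫ r.app X) ◁ (L.kleisliTheta X).hom ▷ L.extExt f =
      (α_ _ _ _).inv ≫ ((S.unit (J.obj X) ≫ r.app X) ◁ (L.kleisliTheta X).hom) ▷ L.extExt f ≫
        (α_ _ _ _).hom := by
    rw [whisker_assoc]; simp
  simp only [Bicategory.whiskerLeft_comp, e, unit_whiskerLeft_kleisliMu,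
    unit_whiskerLeft_kleisliTheta, unit_whiskerLeft_extFunctor_map, Category.assoc,
    Iso.inv_hom_id_assoc, kleisliEta, Iso.trans_hom, Iso.symm_hom, whiskerLeftIso_hom,
    Iso.hom_inv_id_assoc]
  rw [inv_hom_whiskerRight_assoc]
  simp

end

/-- The structure of the extension of `S` to the Kleisli bicategory of `T`. -/
noncomputable def kleisliPseudomonad : KleisliPseudomonad T where
  obj := P.functor.obj
  unit := kleisliUnit r T
  ext {X Y} := L.extFunctor X Y
  mu := L.kleisliMu
  eta := L.kleisliEta
  theta := L.kleisliTheta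
  mu_naturality_right := L.kleisliMu_naturality_right
  mu_naturality_left := fun β f => L.kleisliMu_naturality_left f β
  eta_naturality := L.kleisliEta_naturality
  associativity := L.kleisli_associativity
  unitality := L.kleisli_unitality

end PseudoLifting

end Extension

theorem theorem6p4 {C : Type u₁} [Bicategory.{w₁, v₁} C] [Strict C]
    {D : Type u₂} [Bicategory.{w₂, v₂} D] [Strict D] {J : C ⥤ᵖ D}
    {P : TwoMonad C} {S : TwoMonad D} (r : TwoMonad.Restriction J P S)
    (T : RelPseudomonad J) (L : PseudoLifting T r) :
    ∃ (R : RelPseudomonad (Pseudofunctor.id (KleisliBicat T))) (Q : RelPseudomonad J),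
      R.toKleisliTriple = L.kleisliExtension ∧
      Q.toRelPseudomonadData = T.compositeData R ∧
      ∀ X : C, Q.obj X = T.obj (P.functor.obj X) :=
  -- The extension and composite have the prescribed data by construction, so all three equalities
  -- are definitional.
  ⟨L.kleisliPseudomonad.toRelPseudomonad, L.kleisliPseudomonad.composite, rfl, rfl, fun _ => rfl⟩
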